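/- An infinite time Turing machine has three one-way infinite tapes (input, scratch, output) with cells indexed by $\mathbb N$ and holding bits, a single head that reads the three cells at its position at once, and finitely many states, among them distinct states start, limit and halt. A program is a finite table that assigns to each state and each triple of bits read a new state, a triple of bits to be written and a move of the head to the left or to the right (on the first cell, a move to the left leaves the head where it is). On input $x\in 2^{\omega}$ the computation begins at stage $0$ in the start state, with the head on the first cell, $x$ on the input tape and zeros on the other two tapes. The configuration at stage $\gamma+1$ is obtained from the one at stage $\gamma$ by one application of the table. At a limit stage the machine is in the limit state, the head is on the first cell, and the value of each cell is the $\limsup$ of its values at the earlier stages. The computation ends when the halt state is reached. An ordinal $\alpha$ is clockable if some program on input $0=\langle 0,0,0,\dots\rangle$ halts in exactly $\alpha$ many steps, that is, the machine is not in the halt state at any stage $\gamma\le\alpha$ and is in the halt state at stage $\alpha+1$ (the step from stage $\alpha$ to stage $\alpha+1$ is the act of changing to the halt state). A gap in the clockable ordinals, of size $\sigma>0$, is a maximal interval $[\beta,\beta+\sigma)$ of ordinals none of which is clockable, such that there are larger clockable ordinals (by maximality, $\beta+\sigma$ is then clockable). **Gap Existence Theorem.** There are gaps in the clockable ordinals.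 In fact, for every clockable ordinal $\alpha$ there is a first gap above $\alpha$, that is, a gap whose first element $\beta$ is greater than $\alpha$ and least possible, and this gap has size exactly $\omega$. -/

import Mathlib

universe u

namespace ITTM

/-- The states of a machine: the three distinguished states, and `n` further ones. -/
inductive State (n : ℕ) : Type
  | start : State n
  | limit : State n
  | halt : State n
  | work (i : Fin n) : State n
  deriving DecidableEq

/-- The two directions in which the head can move. -/
inductive Dir : Type
  | left : Dir
  | right : Dir

/-- The three tapes. -/
inductive Tape : Type
  | input : Tape
  | scratch : Tape
  | output : Tape

/-- A program of an infinite time Turing machine: finitely many states and a finite table which,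
for a state and the three bits that the head reads (one on each tape), gives the new state,
the three bits to be written and the direction of the move. `true` is `1` and `false` is `0`. -/
structure Program : Type where
  numWork : ℕ
  next : State numWork → (Tape → Bool) → State numWork × (Tape → Bool) × Dir

/-- A snapshot: the state, the position of the (single) head, and the contents of the tapes,
whose cells are numbered by `ℕ`. -/
structure Config (n : ℕ) : Type where
  state : State n
  head : ℕ
  cell : Tape → ℕ → Bool

/-- Moving the head on a one-way infinite tape; on the first cell, a move to the left leaves
the head where it is. -/
def Dir.move : Dir → ℕ → ℕ
  | .left, k => k - 1
  | .right, k => k + 1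

/-- The configuration in which the machine starts on the input `x`. -/
def initial (n : ℕ) (x : ℕ → Bool) : Config n where
  state := .start
  head := 0
  cell := fun t k => match t with
    | .input => x k
    | .scratch => false
    | .output => false

/-- One step of computation. In the halt state nothing changes any more. -/
def Program.step (p : Program) (c : Config p.numWork) : Config p.numWork :=
  if c.state = .halt then c
  else
    let r := p.next c.state (fun t => c.cell t c.head)
    { state := r.1
      head := r.2.2.move c.head
      cell := fun t => Function.update (c.cell t) c.head (r.2.1 t) }

open Classical in
/-- The configuration at a limit stage `o`, given those at the earlier stages: the limit state,
the head on the first cell, and in each cell the limsup of its earlier values, that is, `1`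
exactly when the cell is `1` at stages that are unbounded below `o`. -/
noncomputable def limitConfig {n : ℕ} (o : Ordinal.{u}) (c : ∀ γ < o, Config n) : Config n where
  state := .limit
  head := 0
  cell := fun t k => decide (∀ δ < o, ∃ γ, ∃ h : γ < o, δ ≤ γ ∧ (c γ h).cell t k = true)

/-- The configuration of the machine with program `p` and input `x` at stage `o`. Only the
stages up to the first one in the halt state belong to the computation. -/
noncomputable def Program.run (p : Program) (x : ℕ → Bool) (o : Ordinal.{u}) :
    Config p.numWork :=
  Ordinal.limitRecOn (motive := fun _ => Config p.numWork) o
    (initial p.numWork x)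
    (fun _ c => p.step c)
    (fun o _ c => limitConfig o c)

theorem Program.run_zero (p : Program) (x : ℕ → Bool) :
    p.run x (0 : Ordinal.{u}) = initial p.numWork x := by
  simp [Program.run]

theorem Program.run_add_one (p : Program) (x : ℕ → Bool) (o : Ordinal.{u}) :
    p.run x (o + 1) = p.step (p.run x o) := by
  simp [Program.run]

theorem Program.run_limit (p : Program) (x : ℕ → Bool) {o : Ordinal.{u}}
    (ho : Order.IsSuccLimit o) :
    p.run x o = limitConfig o (fun γ _ => p.run x γ) := by
  simp [Program.run, Ordinal.limitRecOn_limit _ _ _ _ ho]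

/-- Program `p` on input `x` halts in exactly `α` many steps: the step of index `α`, which leads
from stage `α` to stage `α + 1`, is the act of changing to the halt state, and the machine has
not been in the halt state before. -/
def Program.HaltsIn (p : Program) (x : ℕ → Bool) (α : Ordinal.{u}) : Prop :=
  (∀ γ ≤ α, (p.run x γ).state ≠ .halt) ∧ (p.run x (α + 1)).state = .halt

/-- An ordinal is clockable if some program on input `0` halts in exactly that many steps. -/
def Clockable (α : Ordinal.{u}) : Prop :=
  ∃ p : Program, p.HaltsIn (fun _ => false) α

/-- The ordinals in `[β, β + σ)` form a gap, of size `σ`, in the clockable ordinals: a nonempty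
maximal interval of ordinals that are not clockable, with a clockable ordinal above it. -/
def IsGap (β σ : Ordinal.{u}) : Prop :=
  0 < σ ∧
  (∀ γ, β ≤ γ → γ < β + σ → ¬ Clockable γ) ∧
  (∀ δ < β, ∃ γ, δ ≤ γ ∧ γ < β ∧ Clockable γ) ∧
  Clockable (β + σ)

/-- The gap that starts at `β` and has size `σ` is the first gap above `α`. -/
def IsFirstGapAbove (α β σ : Ordinal.{u}) : Prop :=
  α < β ∧ IsGap β σ ∧ ∀ β' σ', α < β' → IsGap β' σ' → β ≤ β'

end ITTM

/-! Let `β` be the least ordinal above `α` that is not clockable. It exists because there are only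
countably many programs and each clocks at most one ordinal (`exists_forall_clockable_le`). A new
state in front of the halt state delays halting by one step (`Clockable.add_one`), so `β` is a
limit, `β = ω * q`. What remains is that no `β + n` is clockable and that `β + ω` is.

Speed-up (`Clockable.of_add_nat`). Suppose that `p` halts in exactly `β + n` steps. Its last `n + 1`
steps depend only on the first `n + 1` cells at stage `β`. No earlier limit shows the same pattern
on these cells, since otherwise `p` would have halted before `β`. So a machine that simulates `p`
step by step and recognizes the pattern at the limit stage itself can halt in exactly `β` steps. The
recognition uses limsups of two flags: the event "some cell that should be 0 is 1" must not be
cofinal, and the event "all cells that should be 1 have been 1 since the last reset" must be cofinal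
(`limSup_exists`, `limSup_roundRobin`).

End of the gap (`clockable_add_omega`). A machine simulates all programs at once, `ω` steps of each
in every `ω` steps. In the block that begins at `ω * r` it raises a flag if and only if some program
halts in exactly `ω * r` steps, or the program that clocks `α` had not halted before. This happens
for every `r < q`, so the flag is 1 at all nonzero limits up to `β`. It does not happen at `β`, so
the flag is 0 for the first time at `β + ω`, and there the machine halts.

Both arguments need machines whose timing at limits is exact. This is provided once, by
`ControlMachine.clockable`, for machines with blocks of memory and primitive recursive control. The
memory is kept on the input and output tapes, and the control is computed by register programs on
the scratch tape. Each step of such a machine takes finitely many tape steps, during which every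
memory bit has its old or its new value; hence the values at limits are the right ones. The
registers are lost at limits, but the control state there is a constant and can be restored. The two
flags that decide about halting lie on the first cells of the two memory tapes, so that a single
step at the limit stage suffices. -/

namespace ITTM

/-! ### Register programs and primitive recursive functions -/

/-- Programs for registers holding natural numbers; `drain r c` stands for
`while r ≠ 0 do (r := r - 1; c)`. -/
inductive Cmd : Type
  | skip : Cmd
  | inc (r : ℕ) : Cmd
  | seq (c d : Cmd) : Cmd
  | drain (r : ℕ) (c : Cmd) : Cmd

/-- All registers used are below this bound. -/
def Cmd.regBound : Cmd → ℕ
  | .skip => 0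
  | .inc r => r + 1
  | .seq c d => max c.regBound d.regBound
  | .drain r c => max (r + 1) c.regBound

/-- Big-step semantics of register programs. -/
inductive Cmd.Eval : Cmd → (ℕ → ℕ) → (ℕ → ℕ) → Prop
  | skip (s : ℕ → ℕ) : Eval .skip s s
  | inc (r : ℕ) (s : ℕ → ℕ) : Eval (.inc r) s (Function.update s r (s r + 1))
  | seq {c d : Cmd} {s s' s'' : ℕ → ℕ} : Eval c s s' → Eval d s' s'' → Eval (.seq c d) s s''
  | drain_zero {r : ℕ} {c : Cmd} {s : ℕ → ℕ} : s r = 0 → Eval (.drain r c) s s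
  | drain_succ {r k : ℕ} {c : Cmd} {s s' s'' : ℕ → ℕ} : s r = k + 1 →
      Eval c (Function.update s r k) s' → Eval (.drain r c) s' s'' → Eval (.drain r c) s s''

namespace Cmd

/-- Loop rule: `I k` is the invariant while the counter `r` holds `k`. The body starts with the
counter already decreased and must leave it so, which `I k` together with `hr` enforces. -/
theorem eval_drain {r : ℕ} {c : Cmd} (I : ℕ → (ℕ → ℕ) → Prop)
    (hr : ∀ k s, I k s → s r = k)
    (hc : ∀ k s, I (k + 1) s → ∃ s', c.Eval (Function.update s r k) s' ∧ I k s') :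
    ∀ (k : ℕ) (s : ℕ → ℕ), I k s → ∃ s', (drain r c).Eval s s' ∧ I 0 s' := by
  intro k
  induction k with
  | zero => exact fun s h => ⟨s, .drain_zero (hr _ _ h), h⟩
  | succ k ih =>
    intro s h
    obtain ⟨s', h1, h2⟩ := hc k s h
    obtain ⟨s'', h3, h4⟩ := ih s' h2
    exact ⟨s'', .drain_succ (hr _ _ h) h1 h3, h4⟩

/-- Setting a register to zero. -/
def clear (r : ℕ) : Cmd := drain r skip

theorem eval_clear (r : ℕ) (s : ℕ → ℕ) : (clear r).Eval s (Function.update s r 0) := by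
  obtain ⟨s', h, h'⟩ := eval_drain (r := r) (c := skip)
    (fun k t => t = Function.update s r k) (by rintro k _ rfl; simp)
    (by rintro k _ rfl; exact ⟨_, .skip _, by simp⟩) (s r) s (by simp)
  rw [h'] at h
  exact h

/-- Copying register `x` to register `y`, with the help of register `t`. -/
def copy (x y t : ℕ) : Cmd :=
  seq (clear y) (seq (clear t) (seq (drain x (seq (inc y) (inc t))) (drain t (inc x))))

theorem eval_copy {x y t : ℕ} (hxy : x ≠ y) (hxt : x ≠ t) (hyt : y ≠ t) (s : ℕ → ℕ) :
    ∃ s', (copy x y t).Eval s s' ∧ s' y = s x ∧ ∀ r, r ≠ y → r ≠ t → s' r = s r := by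
  obtain ⟨s1, e1, h1⟩ := eval_drain (r := x) (c := seq (inc y) (inc t))
    (fun k u => u x = k ∧ u y + k = s x ∧ u t + k = s x ∧
      ∀ r, r ≠ x → r ≠ y → r ≠ t → u r = s r)
    (fun k u h => h.1)
    (fun k u h => by
      refine ⟨_, .seq (.inc _ _) (.inc _ _), ?_⟩
      obtain ⟨a, b, c, d⟩ := h
      refine ⟨?_, ?_, ?_, ?_⟩
      · simp [Function.update_of_ne, hxy, hxt]
      · simp [Function.update_of_ne, hyt, hxy.symm]; omega
      · simp [Function.update_of_ne, hyt.symm, hxt.symm]; omega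
      · intro r h1 h2 h3
        simp [Function.update_of_ne, h1, h2, h3, d r h1 h2 h3])
    (s x) (Function.update (Function.update s y 0) t 0)
    (by
      refine ⟨?_, ?_, ?_, ?_⟩
      · simp [Function.update_of_ne, hxy, hxt]
      · simp [Function.update_of_ne, hyt]
      · simp
      · intro r h1 h2 h3
        simp [Function.update_of_ne, h2, h3])
  obtain ⟨s2, e2, h2⟩ := eval_drain (r := t) (c := inc x)
    (fun k u => u t = k ∧ u y = s x ∧ u x + k = s x ∧
      ∀ r, r ≠ x → r ≠ y → r ≠ t → u r = s r)
    (fun k u h => h.1)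
    (fun k u h => by
      refine ⟨_, .inc _ _, ?_⟩
      obtain ⟨a, b, c, d⟩ := h
      refine ⟨?_, ?_, ?_, ?_⟩
      · simp [Function.update_of_ne, hxt.symm]
      · simp [Function.update_of_ne, hyt, hxy.symm]; omega
      · simp [Function.update_of_ne, hxt]; omega
      · intro r h1 h2 h3
        simp [Function.update_of_ne, h1, h3, d r h1 h2 h3])
    (s x) s1 (by
      obtain ⟨a, b, c, d⟩ := h1
      exact ⟨by omega, by omega, by omega, d⟩)
  refine ⟨s2, .seq (eval_clear _ _) (.seq (eval_clear _ _) (.seq e1 e2)), h2.2.1, ?_⟩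
  intro r hy ht
  by_cases hx : r = x
  · subst hx; have := h2.2.2.1; omega
  · exact h2.2.2.2 r hx hy ht

/-- The register program `c` computes `f` from the registers `args` to the register `out`, and
changes no other register below `b`. -/
def Computes {n : ℕ} (c : Cmd) (f : List.Vector ℕ n → ℕ) (args : Fin n → ℕ) (out b : ℕ) : Prop :=
  ∀ s : ℕ → ℕ, ∃ s', c.Eval s s' ∧ s' out = f (List.Vector.ofFn fun i => s (args i)) ∧
    ∀ r < b, r ≠ out → s' r = s r

/-- The detour through the auxiliary register `b` makes the case `x = y` harmless, which `copy`
alone does not allow. -/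
theorem exists_move {x y b : ℕ} (hx : x < b) (hy : y < b) :
    ∃ c : Cmd, ∀ s : ℕ → ℕ, ∃ s', c.Eval s s' ∧ s' y = s x ∧ ∀ r < b, r ≠ y → s' r = s r := by
  refine ⟨seq (copy x b (b + 1)) (copy b y (b + 1)), fun s => ?_⟩
  obtain ⟨s1, e1, h1, k1⟩ := eval_copy (x := x) (y := b) (t := b + 1) (by omega) (by omega)
    (by omega) s
  obtain ⟨s2, e2, h2, k2⟩ := eval_copy (x := b) (y := y) (t := b + 1) (by omega) (by omega)
    (by omega) s1
  exact ⟨s2, .seq e1 e2, by rw [h2, h1], fun r hr hry => by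
    rw [k2 r hry (by omega), k1 r (by omega) (by omega)]⟩

/-- Each `g i` is computed with the bound `b + k`, so that neither the arguments nor the values
already stored from register `b` on are lost. -/
theorem exists_computes_list {m k b : ℕ} (g : Fin k → List.Vector ℕ m → ℕ) (args : Fin m → ℕ)
    (ha : ∀ i, args i < b)
    (hg : ∀ i out b', (∀ i, args i < b') → out < b' → ∃ c, Computes c (g i) args out b')
    (j : ℕ) (hj : j ≤ k) :
    ∃ c : Cmd, ∀ s : ℕ → ℕ, ∃ s', c.Eval s s' ∧ (∀ r < b, s' r = s r) ∧
      ∀ i : Fin k, i < j → s' (b + i) = g i (List.Vector.ofFn fun i => s (args i)) := by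
  induction j with
  | zero => exact ⟨skip, fun s => ⟨s, .skip s, fun _ _ => rfl, fun i hi => by omega⟩⟩
  | succ j ih =>
    obtain ⟨c, hc⟩ := ih (by omega)
    obtain ⟨d, hd⟩ := hg ⟨j, hj⟩ (b + j) (b + k) (fun i => by have := ha i; omega) (by omega)
    refine ⟨seq c d, fun s => ?_⟩
    obtain ⟨s1, e1, h1, k1⟩ := hc s
    obtain ⟨s2, e2, h2, k2⟩ := hd s1
    refine ⟨s2, .seq e1 e2, fun r hr => by rw [k2 r (by omega) (by omega), h1 r hr], ?_⟩
    intro i hi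
    have hargs : (fun i => s1 (args i)) = fun i => s (args i) :=
      funext fun i => h1 _ (ha i)
    by_cases hij : (i : ℕ) = j
    · have : i = ⟨j, hj⟩ := Fin.ext hij
      subst this
      rw [← hargs]
      exact h2
    · rw [k2 _ (by omega) (by omega), k1 i (by omega)]

/-- Induction on the generation of primitive recursive functions. Every case uses only registers
from `b` on for its intermediate values, and this makes the constructions compose. -/
theorem exists_computes {n : ℕ} {f : List.Vector ℕ n → ℕ} (hf : Nat.Primrec' f) :
    ∀ (args : Fin n → ℕ) (out b : ℕ), (∀ i, args i < b) → out < b →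
      ∃ c, Computes c f args out b := by
  induction hf with
  | zero =>
    intro args out b _ _
    exact ⟨clear out, fun s => ⟨_, eval_clear out s, by simp, fun r _ hr => by
      simp [Function.update_of_ne, hr]⟩⟩
  | succ =>
    intro args out b ha ho
    obtain ⟨c, hc⟩ := exists_move (ha 0) ho
    refine ⟨seq c (inc out), fun s => ?_⟩
    obtain ⟨s1, e1, h1, k1⟩ := hc s
    exact ⟨_, .seq e1 (.inc _ _), by simp [h1], fun r hr hro => by
      simp [Function.update_of_ne, hro, k1 r hr hro]⟩
  | get i =>
    intro args out b ha ho
    obtain ⟨c, hc⟩ := exists_move (ha i) ho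
    refine ⟨c, fun s => ?_⟩
    obtain ⟨s1, e1, h1, k1⟩ := hc s
    exact ⟨s1, e1, by simp [h1], k1⟩
  | @comp m n f g _ _ hf hg =>
    intro args out b ha ho
    obtain ⟨c, hc⟩ := exists_computes_list g args ha (fun i out b' h1 h2 => hg i args out b' h1 h2)
      n le_rfl
    obtain ⟨d, hd⟩ := hf (fun i => b + i) out (b + n) (fun i => by omega) (by omega)
    refine ⟨seq c d, fun s => ?_⟩
    obtain ⟨s1, e1, h1, k1⟩ := hc s
    obtain ⟨s2, e2, h2, k2⟩ := hd s1
    refine ⟨s2, .seq e1 e2, ?_, fun r hr hro => by rw [k2 r (by omega) hro, h1 r hr]⟩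
    rw [h2]
    congr 2
    exact funext fun i => k1 i i.2
  | @prec n f g _ _ hf hg =>
    intro args out b ha ho
    -- registers: `b` counts down, `b + 1` counts up, `b + 2` accumulates
    obtain ⟨c0, hc0⟩ := hf (fun i => args i.succ) (b + 2) (b + 3)
      (fun i => by have := ha i.succ; omega) (by omega)
    obtain ⟨c1, hc1⟩ := exists_move (x := args 0) (y := b) (b := b + 3)
      (by have := ha 0; omega) (by omega)
    obtain ⟨c2, hc2⟩ := hg (Fin.cases (b + 1) (Fin.cases (b + 2) fun i => args i.succ)) (b + 2)
      (b + 3) (by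
        intro i
        refine Fin.cases ?_ (fun i => ?_) i
        · simp
        · refine Fin.cases ?_ (fun i => ?_) i
          · exact Nat.lt_succ_self (b + 2)
          · have := ha i.succ
            simp only [Fin.cases_succ]; omega) (by omega)
    obtain ⟨c3, hc3⟩ := exists_move (x := b + 2) (y := out) (b := b + 3) (by omega) (by omega)
    refine ⟨seq c0 (seq c1 (seq (clear (b + 1)) (seq (drain b (seq c2 (inc (b + 1)))) c3))),
      fun s => ?_⟩
    obtain ⟨s0, e0, h0, k0⟩ := hc0 s
    obtain ⟨s1, e1, h1, k1⟩ := hc1 s0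
    set v : List.Vector ℕ n := List.Vector.ofFn fun i => s (args i.succ) with hv
    set F : ℕ → ℕ := fun k => Nat.rec (f v) (fun y IH => g (y ::ᵥ IH ::ᵥ v)) k with hF
    -- The sum of the two counters stays equal to the recursion argument, so the accumulator is `F`
    -- of that argument when the loop ends.
    obtain ⟨s2, e2, h2⟩ := eval_drain (r := b) (c := seq c2 (inc (b + 1)))
      (fun k u => u b = k ∧ u (b + 1) + k = s (args 0) ∧ u (b + 2) = F (u (b + 1)) ∧
        ∀ r < b, u r = s r)
      (fun k u h => h.1)
      (fun k u h => by
        obtain ⟨p1, p2, p3, p4⟩ := h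
        obtain ⟨u1, d1, q1, q2⟩ := hc2 (Function.update u b k)
        refine ⟨_, .seq d1 (.inc _ _), ?_, ?_, ?_, ?_⟩
        · rw [Function.update_of_ne (by omega), q2 b (by omega) (by omega)]; simp
        · rw [Function.update_self, q2 (b + 1) (by omega) (by omega)]
          simp; omega
        · rw [Function.update_of_ne (by omega), Function.update_self, q1,
            q2 (b + 1) (by omega) (by omega), Function.update_of_ne (by omega)]
          change _ = g (u (b + 1) ::ᵥ F (u (b + 1)) ::ᵥ v)
          congr 1
          simp only [List.Vector.ofFn, Fin.cases_zero, Fin.cases_succ]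
          rw [Function.update_of_ne (by omega), Function.update_of_ne (by omega), p3, hv]
          congr 4
          funext i
          have := ha i.succ
          rw [Function.update_of_ne (by omega), p4 _ this]
        · intro r hr
          rw [Function.update_of_ne (by omega), q2 r (by omega) (by omega),
            Function.update_of_ne (by omega), p4 r hr])
      (s (args 0)) (Function.update s1 (b + 1) 0) (by
        refine ⟨?_, ?_, ?_, ?_⟩
        · rw [Function.update_of_ne (by omega), h1, k0 _ (by have := ha 0; omega)
            (by have := ha 0; omega)]
        · simp
        · rw [Function.update_of_ne (by omega), k1 _ (by omega) (by omega), h0]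
          simp [hF, hv]
        · intro r hr
          rw [Function.update_of_ne (by omega), k1 _ (by omega) (by omega),
            k0 _ (by omega) (by omega)])
    obtain ⟨s3, e3, h3, k3⟩ := hc3 s2
    obtain ⟨_, p2, p3, p4⟩ := h2
    refine ⟨s3, .seq e0 (.seq e1 (.seq (eval_clear _ _) (.seq e2 e3))), ?_, ?_⟩
    · rw [h3, p3, show s2 (b + 1) = s (args 0) by omega]
      simp [List.Vector.ofFn, hF, hv]
    · intro r hr hro
      rw [k3 r (by omega) hro, p4 r hr]

/-- Primitive recursive functions of one argument are computed by register programs. -/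
theorem exists_computes_nat {f : ℕ → ℕ} (hf : Primrec f) {x out b : ℕ} (hx : x < b)
    (ho : out < b) :
    ∃ c : Cmd, ∀ s : ℕ → ℕ, ∃ s', c.Eval s s' ∧ s' out = f (s x) ∧
      ∀ r < b, r ≠ out → s' r = s r := by
  obtain ⟨c, hc⟩ := exists_computes (Nat.Primrec'.prim_iff₁.2 hf) (fun _ => x) out b
    (fun _ => hx) ho
  refine ⟨c, fun s => ?_⟩
  obtain ⟨s', h1, h2, h3⟩ := hc s
  exact ⟨s', h1, by simpa [List.Vector.ofFn] using h2, h3⟩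

end Cmd

/-! ### Open machines -/

/-- The head position and the contents of the tapes. -/
structure TapeConfig : Type where
  head : ℕ
  cell : Tape → ℕ → Bool

namespace TapeConfig

/-- The bits under the head. -/
def bits (c : TapeConfig) : Tape → Bool := fun t => c.cell t c.head

/-- Writing the bits `w` and moving the head in direction `d`. -/
def put (c : TapeConfig) (w : Tape → Bool) (d : Dir) : TapeConfig :=
  ⟨d.move c.head, fun t => Function.update (c.cell t) c.head (w t)⟩

end TapeConfig

/-- The tape that holds part of the memory: the output tape for `true`, the input tape for
`false`. -/
def ioTape (b : Bool) : Tape := if b then .output else .input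

/-- The contents of the input and of the output tape. -/
def io (cell : Tape → ℕ → Bool) : Bool → ℕ → Bool := fun b => cell (ioTape b)

/-- A finite table with exits of type `E` and an entry state. -/
structure Gadget (E : Type) : Type 1 where
  Q : Type
  fin : Finite Q
  entry : Q
  next : Q → (Tape → Bool) → (Q ⊕ E) × (Tape → Bool) × Dir

namespace Gadget

variable {E E' : Type}

/-- `G.Exec P q c e c'`: from the state `q` and the tapes `c`, the table `G` leads to the exit `e`
with the tapes `c'`, and `P` holds of the input and output tapes before each step. -/
inductive Exec (G : Gadget E) (P : (Bool → ℕ → Bool) → Prop) :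
    G.Q → TapeConfig → E → TapeConfig → Prop
  | exit {q : G.Q} {c : TapeConfig} {e : E} {w : Tape → Bool} {d : Dir} :
      P (io c.cell) → G.next q c.bits = (.inr e, w, d) → Exec G P q c e (c.put w d)
  | step {q q' : G.Q} {c c' : TapeConfig} {e : E} {w : Tape → Bool} {d : Dir} :
      P (io c.cell) → G.next q c.bits = (.inl q', w, d) → Exec G P q' (c.put w d) e c' →
      Exec G P q c e c'

/-- Execution from the entry state. -/
def Runs (G : Gadget E) (P : (Bool → ℕ → Bool) → Prop) (c : TapeConfig) (e : E)
    (c' : TapeConfig) : Prop :=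
  G.Exec P G.entry c e c'

/-- A single step. -/
def act (f : (Tape → Bool) → E × (Tape → Bool) × Dir) : Gadget E where
  Q := Unit
  fin := inferInstance
  entry := ()
  next _ b := (.inr (f b).1, (f b).2)

theorem runs_act {P : (Bool → ℕ → Bool) → Prop} (f : (Tape → Bool) → E × (Tape → Bool) × Dir)
    {c : TapeConfig} (hP : P (io c.cell)) :
    (act f).Runs P c (f c.bits).1 (c.put (f c.bits).2.1 (f c.bits).2.2) :=
  .exit hP rfl

/-- Sequential composition, where the second table may depend on the exit of the first one. -/
def bind [Finite E] (G : Gadget E) (k : E → Gadget E') : Gadget E' where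
  Q := G.Q ⊕ Σ e, (k e).Q
  fin := by
    have := G.fin
    have := fun e => (k e).fin
    infer_instance
  entry := .inl G.entry
  next
    | .inl q, b =>
      match G.next q b with
      | (.inl q', r) => (.inl (.inl q'), r)
      | (.inr e, r) => (.inl (.inr ⟨e, (k e).entry⟩), r)
    | .inr ⟨e, q⟩, b =>
      match (k e).next q b with
      | (.inl q', r) => (.inl (.inr ⟨e, q'⟩), r)
      | (.inr e', r) => (.inr e', r)

theorem runs_bind [Finite E] {P : (Bool → ℕ → Bool) → Prop} {G : Gadget E} {k : E → Gadget E'}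
    {c c' c'' : TapeConfig} {e : E} {e' : E'} (h : G.Runs P c e c')
    (h' : (k e).Runs P c' e' c'') : (G.bind k).Runs P c e' c'' := by
  have key2 : ∀ {q c e' c''}, (k e).Exec P q c e' c'' →
      (G.bind k).Exec P (.inr ⟨e, q⟩) c e' c'' := by
    intro q c e' c'' h
    induction h with
    | exit hP hn => exact .exit hP (by simp [bind, hn])
    | step hP hn _ ih => exact .step hP (by simp only [bind, hn]) ih
  have key : ∀ {q c e c'}, G.Exec P q c e c' → ((G.bind k).Exec P (.inr ⟨e, (k e).entry⟩) c' e' c'' →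
      (G.bind k).Exec P (.inl q) c e' c'') := by
    intro q c e c' h
    induction h with
    | exit hP hn => exact fun h => .step hP (by simp only [bind, hn]) h
    | step hP hn _ ih => exact fun h => .step hP (by simp only [bind, hn]) (ih h)
  exact key h (key2 h')

/-- Repetition: the exit `none` leads back to the entry. -/
def loop (G : Gadget (Option E)) : Gadget E where
  Q := G.Q
  fin := G.fin
  entry := G.entry
  next q b :=
    match G.next q b with
    | (.inl q', r) => (.inl q', r)
    | (.inr none, r) => (.inl G.entry, r)
    | (.inr (some e), r) => (.inr e, r)

theorem runs_loop_some {P : (Bool → ℕ → Bool) → Prop} {G : Gadget (Option E)}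
    {c c' : TapeConfig} {e : E} (h : G.Runs P c (some e) c') : G.loop.Runs P c e c' := by
  have key : ∀ {q c o c'}, G.Exec P q c o c' → o = some e → G.loop.Exec P q c e c' := by
    intro q c o c' h
    induction h with
    | exit hP hn => rintro rfl; exact .exit hP (by simp only [loop, hn])
    | step hP hn _ ih => exact fun h => .step hP (by simp only [loop, hn]) (ih h)
  exact key h rfl

theorem runs_loop_none {P : (Bool → ℕ → Bool) → Prop} {G : Gadget (Option E)}
    {c c' c'' : TapeConfig} {e : E} (h : G.Runs P c none c') (h' : G.loop.Runs P c' e c'') :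
    G.loop.Runs P c e c'' := by
  have key : ∀ {q c o c'}, G.Exec P q c o c' → o = none →
      (G.loop.Runs P c' e c'' → G.loop.Exec P q c e c'') := by
    intro q c o c' h
    induction h with
    | exit hP hn => rintro rfl; exact fun h => .step hP (by simp only [loop, hn]) h
    | step hP hn _ ih => exact fun h h' => .step hP (by simp only [loop, hn]) (ih h h')
  exact key h rfl h'

/-! ### Basic operations -/

/-- One move of the head. -/
def move (d : Dir) : Gadget Unit := act fun b => ((), b, d)

theorem runs_move {P : (Bool → ℕ → Bool) → Prop} (d : Dir) {h : ℕ} {cell : Tape → ℕ → Bool}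
    (hP : P (io cell)) : (move d).Runs P ⟨h, cell⟩ () ⟨d.move h, cell⟩ := by
  have := runs_act (fun b => ((), b, d)) (c := ⟨h, cell⟩) hP
  simpa [TapeConfig.put, TapeConfig.bits, move] using this

/-- The tapes after writing the bits `w` at `h`. -/
def putAt (cell : Tape → ℕ → Bool) (h : ℕ) (w : Tape → Bool) : Tape → ℕ → Bool :=
  fun t => Function.update (cell t) h (w t)

/-- Reading and writing without moving the head (unless it is moved to the right and back). -/
def modify [Finite E] (f : (Tape → Bool) → E × (Tape → Bool)) : Gadget E :=
  (act fun b => ((f b).1, (f b).2, Dir.right)).bind fun e => act fun b => (e, b, Dir.left)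

theorem runs_modify [Finite E] {P : (Bool → ℕ → Bool) → Prop}
    (f : (Tape → Bool) → E × (Tape → Bool)) {h : ℕ} {cell : Tape → ℕ → Bool} (hP : P (io cell))
    (hP' : P (io (putAt cell h (f fun t => cell t h).2))) :
    (modify f).Runs P ⟨h, cell⟩ (f fun t => cell t h).1
      ⟨h, putAt cell h (f fun t => cell t h).2⟩ := by
  refine runs_bind (runs_act _ hP) ?_
  have := runs_act (fun b => ((f fun t => cell t h).1, b, Dir.left))
    (c := ⟨h + 1, putAt cell h (f fun t => cell t h).2⟩) hP'
  have e : (⟨h + 1, putAt cell h (f fun t => cell t h).2⟩ : TapeConfig).put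
      (TapeConfig.bits ⟨h + 1, putAt cell h (f fun t => cell t h).2⟩) .left =
      ⟨h, putAt cell h (f fun t => cell t h).2⟩ := by
    simp [TapeConfig.put, TapeConfig.bits, Dir.move]
  rw [e] at this
  exact this

/-- Doing nothing. -/
def nop (e : E) : Gadget E :=
  (act fun b => ((), b, Dir.right)).bind fun _ => act fun b => (e, b, Dir.left)

theorem runs_nop {P : (Bool → ℕ → Bool) → Prop} (e : E) {c : TapeConfig}
    (hP : P (io c.cell)) : (nop e).Runs P c e c := by
  refine runs_bind (runs_act _ hP) ?_
  have := runs_act (fun b => (e, b, Dir.left)) (c := ⟨c.head + 1, c.cell⟩) hP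
  simpa [TapeConfig.put, TapeConfig.bits, Dir.move] using this

/-- Several moves of the head. -/
def moves (d : Dir) : ℕ → Gadget Unit
  | 0 => nop ()
  | n + 1 => (move d).bind fun _ => moves d n

theorem runs_moves_right {P : (Bool → ℕ → Bool) → Prop} (n : ℕ) {h : ℕ}
    {cell : Tape → ℕ → Bool} (hP : P (io cell)) :
    (moves .right n).Runs P ⟨h, cell⟩ () ⟨h + n, cell⟩ := by
  induction n generalizing h with
  | zero => exact runs_nop _ hP
  | succ n ih =>
    have := ih (h := h + 1)
    rw [show h + (n + 1) = h + 1 + n by omega]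
    exact runs_bind (runs_move .right hP) this

theorem runs_moves_left {P : (Bool → ℕ → Bool) → Prop} (n : ℕ) {h : ℕ}
    {cell : Tape → ℕ → Bool} (hP : P (io cell)) :
    (moves .left n).Runs P ⟨h + n, cell⟩ () ⟨h, cell⟩ := by
  induction n generalizing h with
  | zero => exact runs_nop _ hP
  | succ n ih => exact runs_bind (runs_move .left hP) (ih (h := h))

/-- The bits `b`, with `x` on the scratch tape. -/
def withScratch (b : Tape → Bool) (x : Bool) : Tape → Bool := fun t =>
  match t with
  | .scratch => x
  | t => b t

/-- Writing `x` on the scratch tape. -/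
def writeScratch (x : Bool) : Gadget Unit := modify fun b => ((), withScratch b x)

/-- The tapes after writing `x` on the scratch tape at `h`. -/
def putScratch (cell : Tape → ℕ → Bool) (h : ℕ) (x : Bool) : Tape → ℕ → Bool := fun t =>
  match t with
  | .scratch => Function.update (cell .scratch) h x
  | t => cell t

@[simp] theorem putScratch_scratch (cell : Tape → ℕ → Bool) (h : ℕ) (x : Bool) :
    putScratch cell h x .scratch = Function.update (cell .scratch) h x := rfl

@[simp] theorem io_putScratch (cell : Tape → ℕ → Bool) (h : ℕ) (x : Bool) :
    io (putScratch cell h x) = io cell := by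
  funext b
  cases b <;> rfl

theorem runs_writeScratch {P : (Bool → ℕ → Bool) → Prop} (x : Bool) {h : ℕ}
    {cell : Tape → ℕ → Bool} (hP : P (io cell)) :
    (writeScratch x).Runs P ⟨h, cell⟩ () ⟨h, putScratch cell h x⟩ := by
  have e : putAt cell h (withScratch (fun t => cell t h) x) = putScratch cell h x := by
    funext t
    cases t <;> simp [putAt, withScratch, putScratch]
  have := runs_modify (P := P) (fun b => ((), withScratch b x)) (h := h) (cell := cell) hP
    (by rw [e]; simpa using hP)
  simp only [e] at this
  exact this

/-- Reading the scratch tape. -/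
def readScratch : Gadget Bool := modify fun b => (b .scratch, b)

theorem runs_readScratch {P : (Bool → ℕ → Bool) → Prop} {h : ℕ}
    {cell : Tape → ℕ → Bool} (hP : P (io cell)) :
    readScratch.Runs P ⟨h, cell⟩ (cell .scratch h) ⟨h, cell⟩ := by
  have e : putAt cell h (fun t => cell t h) = cell := by
    funext t
    simp [putAt]
  have := runs_modify (P := P) (fun b => (b .scratch, b)) (h := h) (cell := cell) hP
    (by rw [e]; simpa using hP)
  simp only [e] at this
  exact this

/-- Moving in steps of length `L` to the next `1` on the scratch tape. -/
def scan (d : Dir) (L : ℕ) : Gadget Unit :=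
  loop (readScratch.bind fun x => if x then nop (some ()) else (moves d L).bind fun _ => nop none)

theorem runs_scan_right {P : (Bool → ℕ → Bool) → Prop} {L : ℕ} (n : ℕ) {h : ℕ}
    {cell : Tape → ℕ → Bool} (hP : P (io cell)) (h0 : ∀ j < n, cell .scratch (h + j * L) = false)
    (h1 : cell .scratch (h + n * L) = true) :
    (scan .right L).Runs P ⟨h, cell⟩ () ⟨h + n * L, cell⟩ := by
  induction n generalizing h with
  | zero =>
    refine runs_loop_some (runs_bind (runs_readScratch hP) ?_)
    have h1' : cell .scratch h = true := by simpa using h1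
    simpa [h1'] using runs_nop (some ()) (c := ⟨h, cell⟩) hP
  | succ n ih =>
    have h0' : cell .scratch h = false := by simpa using h0 0 (by omega)
    have e : h + (n + 1) * L = h + L + n * L := by ring
    rw [e]
    refine runs_loop_none (c' := ⟨h + L, cell⟩) (runs_bind (runs_readScratch hP) ?_)
      (ih (h := h + L) ?_ (by rwa [← e]))
    · simp only [h0', Bool.false_eq_true, if_false]
      exact runs_bind (runs_moves_right L hP) (runs_nop _ hP)
    · intro j hj
      have := h0 (j + 1) (by omega)
      rwa [show h + (j + 1) * L = h + L + j * L by ring] at this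

theorem runs_scan_left {P : (Bool → ℕ → Bool) → Prop} {L : ℕ} (n : ℕ) {h : ℕ}
    {cell : Tape → ℕ → Bool} (hP : P (io cell))
    (h0 : ∀ j < n, cell .scratch (h + (j + 1) * L) = false)
    (h1 : cell .scratch h = true) :
    (scan .left L).Runs P ⟨h + n * L, cell⟩ () ⟨h, cell⟩ := by
  induction n with
  | zero =>
    refine runs_loop_some (runs_bind (runs_readScratch hP) ?_)
    simpa [h1] using runs_nop (some ()) (c := ⟨h, cell⟩) hP
  | succ n ih =>
    have h0' := h0 n (by omega)
    refine runs_loop_none (c' := ⟨h + n * L, cell⟩) (runs_bind (runs_readScratch hP) ?_)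
      (ih fun j hj => h0 j (by omega))
    rw [h0']
    simp only [Bool.false_eq_true, if_false]
    rw [show h + (n + 1) * L = h + n * L + L by ring]
    exact runs_bind (runs_moves_left L hP) (runs_nop _ hP)

end Gadget

/-! ### Registers on the scratch tape -/

/-- The registers `s` on the scratch tape, which is divided into blocks of length `L`. The value of
register `r` is the number of zeros in the cells of offset `r` before the first `1`, where the
first block, which is constantly `1`, does not count. What follows that `1` is arbitrary. -/
structure RegTape (L : ℕ) (s : ℕ → ℕ) (x : ℕ → Bool) : Prop where
  base : ∀ r < L, x r = true
  zeros : ∀ r < L, ∀ j < s r, x (L + r + j * L) = false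
  mark : ∀ r < L, x (L + r + s r * L) = true

theorem block_eq {L a b r r' : ℕ} (hr : r < L) (hr' : r' < L) (h : L * a + r = L * b + r') :
    a = b ∧ r = r' := by
  have h1 := congrArg (· % L) h
  simp only [Nat.mul_add_mod, Nat.mod_eq_of_lt hr, Nat.mod_eq_of_lt hr'] at h1
  have h2 := congrArg (· / L) h
  have hL : 0 < L := by omega
  simp only [Nat.mul_add_div hL, Nat.div_eq_of_lt hr, Nat.div_eq_of_lt hr', add_zero] at h2
  exact ⟨h2, h1⟩

theorem mark_inj {L a b r r' : ℕ} (hr : r < L) (hr' : r' < L)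
    (h : L + r + a * L = L + r' + b * L) : a = b ∧ r = r' := by
  refine block_eq hr hr' ?_
  linarith [mul_comm a L, mul_comm b L]

theorem RegTape.update_mark {L : ℕ} {s : ℕ → ℕ} {x y : ℕ → Bool} (h : RegTape L s x) {r v : ℕ}
    (hr : r < L)
    (hbase : ∀ k < L, y k = x k)
    (hother : ∀ r' < L, r' ≠ r → ∀ j, y (L + r' + j * L) = x (L + r' + j * L))
    (hzeros : ∀ j < v, y (L + r + j * L) = false) (hmark : y (L + r + v * L) = true) :
    RegTape L (Function.update s r v) y where
  base k hk := by rw [hbase k hk, h.base k hk]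
  zeros r' hr' j hj := by
    by_cases e : r' = r
    · subst e
      exact hzeros j (by simpa using hj)
    · rw [hother r' hr' e, h.zeros r' hr' j (by simpa [e] using hj)]
  mark r' hr' := by
    by_cases e : r' = r
    · subst e
      simpa using hmark
    · rw [hother r' hr' e]
      simpa [e] using h.mark r' hr'

namespace Gadget

variable {E E' : Type}

/-- Sequential composition. -/
def andThen (G : Gadget Unit) (H : Gadget E) : Gadget E := G.bind fun _ => H

theorem runs_andThen {P : (Bool → ℕ → Bool) → Prop} {G : Gadget Unit} {H : Gadget E}
    {c c' c'' : TapeConfig} {e : E} (h : G.Runs P c () c') (h' : H.Runs P c' e c'') :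
    (G.andThen H).Runs P c e c'' :=
  runs_bind h h'

/-- Moving from the first cell to the mark of register `r`. -/
def toMark (L r : ℕ) : Gadget Unit := (moves .right (L + r)).andThen (scan .right L)

theorem runs_toMark {P : (Bool → ℕ → Bool) → Prop} {L r : ℕ} (hr : r < L) {s : ℕ → ℕ}
    {cell : Tape → ℕ → Bool} (hs : RegTape L s (cell .scratch)) (hP : P (io cell)) :
    (toMark L r).Runs P ⟨0, cell⟩ () ⟨L + r + s r * L, cell⟩ := by
  have h := runs_moves_right (L + r) (h := 0) hP
  rw [zero_add] at h
  exact runs_andThen h (runs_scan_right _ hP (hs.zeros r hr) (hs.mark r hr))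

/-- Moving to the first cell from a cell of offset `r`. -/
def toHome (L r : ℕ) : Gadget Unit := (scan .left L).andThen (moves .left r)

theorem runs_toHome {P : (Bool → ℕ → Bool) → Prop} {L r n : ℕ} {cell : Tape → ℕ → Bool}
    (h0 : ∀ j < n, cell .scratch (L + r + j * L) = false) (h1 : cell .scratch r = true)
    (hP : P (io cell)) : (toHome L r).Runs P ⟨r + n * L, cell⟩ () ⟨0, cell⟩ := by
  have h := runs_moves_left r (h := 0) hP
  rw [zero_add] at h
  refine runs_andThen (runs_scan_left n hP (fun j hj => ?_) h1) h
  rw [← h0 j hj]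
  congr 1
  ring

/-- Incrementing register `r`. -/
def incReg (L r : ℕ) : Gadget Unit :=
  (toMark L r).andThen <| (writeScratch false).andThen <| (moves .right L).andThen <|
    (writeScratch true).andThen <| (moves .left L).andThen <| toHome L r

/-- The mark is erased and set again one block further. The cells of this offset between the base
block and the new mark are then zeros, so the scan back to the left stops only in the base block. -/
theorem runs_incReg {P : (Bool → ℕ → Bool) → Prop} {L r : ℕ} (hr : r < L) {s : ℕ → ℕ}
    {cell : Tape → ℕ → Bool} (hs : RegTape L s (cell .scratch)) (hP : P (io cell)) :
    ∃ cell', (incReg L r).Runs P ⟨0, cell⟩ () ⟨0, cell'⟩ ∧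
      RegTape L (Function.update s r (s r + 1)) (cell' .scratch) ∧ io cell' = io cell := by
  have hL : 0 < L := by omega
  set p := L + r + s r * L with hp
  set cell' := putScratch (putScratch cell p false) (p + L) true with hc
  have hx : cell' .scratch =
    Function.update (Function.update (cell .scratch) p false) (p + L) true := rfl
  have hpL : p + L = L + r + (s r + 1) * L := by rw [hp]; ring
  have hs' : RegTape L (Function.update s r (s r + 1)) (cell' .scratch) := by
    rw [hx]
    refine hs.update_mark hr ?_ ?_ ?_ ?_
    · intro k hk
      rw [Function.update_of_ne (by omega), Function.update_of_ne (by omega)]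
    · intro r' hr' hne j
      rw [hpL, Function.update_of_ne, Function.update_of_ne]
      · exact fun h => hne (mark_inj hr' hr h).2
      · exact fun h => hne (mark_inj hr' hr h).2
    · intro j hj
      have : L + r + j * L ≠ p + L := fun h => by
        rw [hpL] at h; have := (mark_inj hr hr h).1; omega
      rw [Function.update_of_ne this]
      by_cases e : j = s r
      · subst e; simp [hp]
      · rw [Function.update_of_ne fun h => e (mark_inj hr hr h).1, hs.zeros r hr j (by omega)]
    · rw [hpL]; simp
  refine ⟨cell', ?_, hs', by simp [hc]⟩
  refine runs_andThen (runs_toMark hr hs hP) (runs_andThen (runs_writeScratch false hP) ?_)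
  have hP1 : P (io (putScratch cell p false)) := by simpa using hP
  have hP2 : P (io cell') := by simpa [hc] using hP
  refine runs_andThen (runs_moves_right L hP1) (runs_andThen (runs_writeScratch true hP1) ?_)
  refine runs_andThen (runs_moves_left L hP2) ?_
  have e : L + r + s r * L = r + (s r + 1) * L := by ring
  have h := runs_toHome (n := s r + 1) (fun j hj => hs'.zeros r hr j (by simpa using hj))
    (hs'.base r hr) hP2
  rwa [← e] at h

/-- Decrementing register `r` and reporting whether this was possible. -/
def decReg (L r : ℕ) : Gadget Bool :=
  (toMark L r).andThen <| (moves .left L).andThen <| readScratch.bind fun x =>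
    if x then (moves .left r).andThen (nop false) else
      (writeScratch true).andThen <| (moves .left L).andThen <| (toHome L r).andThen (nop true)

/-- A register is zero exactly if the cell one block to the left of its mark is a `1`, because that
cell then belongs to the base block. -/
theorem runs_decReg_zero {P : (Bool → ℕ → Bool) → Prop} {L r : ℕ} (hr : r < L) {s : ℕ → ℕ}
    {cell : Tape → ℕ → Bool} (hs : RegTape L s (cell .scratch)) (hP : P (io cell))
    (h0 : s r = 0) : (decReg L r).Runs P ⟨0, cell⟩ false ⟨0, cell⟩ := by
  refine runs_andThen (runs_toMark hr hs hP) (c' := ⟨L + r + s r * L, cell⟩) ?_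
  rw [h0, show L + r + 0 * L = r + L by ring]
  refine runs_andThen (runs_moves_left L hP) (runs_bind (runs_readScratch hP) ?_)
  simp only [hs.base r hr, if_true]
  have h := runs_moves_left r (h := 0) hP
  rw [zero_add] at h
  exact runs_andThen h (runs_nop _ hP)

/-- Overwriting the last zero by `1` makes it the new mark. The old mark remains as garbage behind
it, which `RegTape` permits. -/
theorem runs_decReg_succ {P : (Bool → ℕ → Bool) → Prop} {L r k : ℕ} (hr : r < L) {s : ℕ → ℕ}
    {cell : Tape → ℕ → Bool} (hs : RegTape L s (cell .scratch)) (hP : P (io cell))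
    (h0 : s r = k + 1) :
    ∃ cell', (decReg L r).Runs P ⟨0, cell⟩ true ⟨0, cell'⟩ ∧
      RegTape L (Function.update s r k) (cell' .scratch) ∧ io cell' = io cell := by
  have hL : 0 < L := by omega
  set p := L + r + k * L with hp
  set cell' := putScratch cell p true with hc
  have hx : cell' .scratch = Function.update (cell .scratch) p true := rfl
  have hs' : RegTape L (Function.update s r k) (cell' .scratch) := by
    rw [hx]
    refine hs.update_mark hr ?_ ?_ ?_ ?_
    · intro j hj
      rw [Function.update_of_ne (by omega)]
    · intro r' hr' hne j
      rw [Function.update_of_ne]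
      exact fun h => hne (mark_inj hr' hr h).2
    · intro j hj
      rw [Function.update_of_ne fun h => by have := (mark_inj hr hr h).1; omega]
      exact hs.zeros r hr j (by omega)
    · simp [hp]
  have hP2 : P (io cell') := by simpa [hc] using hP
  refine ⟨cell', ?_, hs', by simp [hc]⟩
  refine runs_andThen (runs_toMark hr hs hP) (c' := ⟨L + r + s r * L, cell⟩) ?_
  rw [h0, show L + r + (k + 1) * L = p + L by rw [hp]; ring]
  refine runs_andThen (runs_moves_left L hP) (runs_bind (runs_readScratch hP) ?_)
  simp only [hp, hs.zeros r hr k (by omega), Bool.false_eq_true, if_false]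
  refine runs_andThen (runs_writeScratch true hP) ?_
  rw [show L + r + k * L = r + k * L + L by ring]
  refine runs_andThen (c' := ⟨r + k * L, cell'⟩) ?_ ?_
  · rw [show r + k * L + L = p by rw [hp]; ring]
    have h := runs_moves_left L (h := r + k * L) hP2
    rwa [show r + k * L + L = p by rw [hp]; ring] at h
  refine runs_andThen (runs_toHome (fun j hj => ?_) (hs'.base r hr) hP2) (runs_nop _ hP2)
  exact hs'.zeros r hr j (by simpa using hj)

end Gadget

/-! ### Register programs as tables -/

open Gadget

/-- The translation of register programs. -/
def Cmd.gadget (L : ℕ) : Cmd → Gadget Unit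
  | .skip => nop ()
  | .inc r => incReg L r
  | .seq c d => (c.gadget L).andThen (d.gadget L)
  | .drain r c => loop <| (decReg L r).bind fun x =>
      if x then (c.gadget L).andThen (nop none) else nop (some ())

/-- Only the scratch tape is written, so a condition `P` on the other two tapes holds throughout. -/
theorem Cmd.Eval.runs {c : Cmd} {s s' : ℕ → ℕ} (h : c.Eval s s')
    {P : (Bool → ℕ → Bool) → Prop} {L : ℕ} (hL : c.regBound ≤ L) :
    ∀ {cell : Tape → ℕ → Bool}, RegTape L s (cell .scratch) → P (io cell) →
    ∃ cell', (c.gadget L).Runs P ⟨0, cell⟩ () ⟨0, cell'⟩ ∧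
      RegTape L s' (cell' .scratch) ∧ io cell' = io cell := by
  induction h with
  | skip s => exact fun hs hP => ⟨_, runs_nop _ hP, hs, rfl⟩
  | inc r s => exact fun hs hP => runs_incReg (by simp only [Cmd.regBound] at hL; omega) hs hP
  | seq _ _ ih1 ih2 =>
    intro cell hs hP
    simp only [Cmd.regBound, max_le_iff] at hL
    obtain ⟨c1, r1, s1, i1⟩ := ih1 hL.1 hs hP
    obtain ⟨c2, r2, s2, i2⟩ := ih2 hL.2 s1 (by rwa [i1])
    exact ⟨c2, runs_andThen r1 r2, s2, by rw [i2, i1]⟩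
  | drain_zero h0 =>
    intro cell hs hP
    simp only [Cmd.regBound, max_le_iff] at hL
    refine ⟨cell, runs_loop_some (runs_bind (runs_decReg_zero (by omega) hs hP h0) ?_), hs, rfl⟩
    exact runs_nop _ hP
  | drain_succ h0 _ _ ih1 ih2 =>
    intro cell hs hP
    have hL' := hL
    simp only [Cmd.regBound, max_le_iff] at hL
    obtain ⟨c0, r0, s0, i0⟩ := runs_decReg_succ (by omega) hs hP h0
    obtain ⟨c1, r1, s1, i1⟩ := ih1 hL.2 s0 (by rwa [i0])
    obtain ⟨c2, r2, s2, i2⟩ := ih2 hL' s1 (by rwa [i1, i0])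
    refine ⟨c2, runs_loop_none (runs_bind r0 ?_) r2, s2, by rw [i2, i1, i0]⟩
    exact runs_andThen r1 (runs_nop _ (by rwa [i1, i0]))

namespace Gadget

/-- Writing ones on the scratch tape. -/
def fill : ℕ → Gadget Unit
  | 0 => nop ()
  | n + 1 => (writeScratch true).andThen <| (move .right).andThen <| fill n

theorem runs_fill {P : (Bool → ℕ → Bool) → Prop} (n : ℕ) {h : ℕ} {cell : Tape → ℕ → Bool}
    (hP : P (io cell)) :
    ∃ cell', (fill n).Runs P ⟨h, cell⟩ () ⟨h + n, cell'⟩ ∧ io cell' = io cell ∧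
      (∀ k < h, cell' .scratch k = cell .scratch k) ∧
      ∀ k, h ≤ k → k < h + n → cell' .scratch k = true := by
  induction n generalizing h cell with
  | zero => exact ⟨cell, runs_nop _ hP, rfl, fun _ _ => rfl, fun k h1 h2 => by omega⟩
  | succ n ih =>
    have hP1 : P (io (putScratch cell h true)) := by simpa using hP
    obtain ⟨c1, r1, i1, a1, b1⟩ := ih (h := h + 1) hP1
    refine ⟨c1, ?_, by simpa using i1, fun k hk => ?_, fun k h1 h2 => ?_⟩
    · rw [show h + (n + 1) = h + 1 + n by omega]
      exact runs_andThen (runs_writeScratch true hP) (runs_andThen (runs_move .right hP1) r1)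
    · rw [a1 k (by omega)]
      simp [Function.update_of_ne (show k ≠ h by omega)]
    · by_cases e : k = h
      · rw [a1 k (by omega)]
        simp [e]
      · exact b1 k (by omega) (by omega)

/-- Setting all registers to zero. -/
def resetRegs (L : ℕ) : Gadget Unit := (fill (L + L)).andThen (moves .left (L + L))

/-- The first `L` ones are the base block and the next `L` are marks of the value zero. The previous
contents of the scratch tape are irrelevant, so this also works on what a limit stage leaves there.
-/
theorem runs_resetRegs {P : (Bool → ℕ → Bool) → Prop} (L : ℕ) {cell : Tape → ℕ → Bool}
    (hP : P (io cell)) :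
    ∃ cell', (resetRegs L).Runs P ⟨0, cell⟩ () ⟨0, cell'⟩ ∧
      RegTape L (fun _ => 0) (cell' .scratch) ∧ io cell' = io cell := by
  obtain ⟨c1, r1, i1, _, b1⟩ := runs_fill (L + L) (h := 0) hP
  refine ⟨c1, runs_andThen r1 (runs_moves_left (L + L) (h := 0) (by rwa [i1])), ?_, i1⟩
  exact ⟨fun r hr => b1 r (by omega) (by omega), fun r hr j hj => absurd hj (by omega),
    fun r hr => b1 _ (by omega) (by omega)⟩

/-! ### Access to the memory -/

/-- The tapes `x` after changing the bit on tape `b` at cell `k`. -/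
def modifyIO (x : Bool → ℕ → Bool) (b : Bool) (k : ℕ) (f : Bool → Bool) : Bool → ℕ → Bool :=
  Function.update x b (Function.update (x b) k (f (x b k)))

instance : DecidableEq Tape := fun a b => by
  cases a <;> cases b <;> first | exact isTrue rfl | exact isFalse nofun

/-- Reading and changing the bit under the head on tape `b`. -/
def modifyTape (b : Bool) (f : Bool → Bool) : Gadget Bool :=
  modify fun w => (w (ioTape b), fun t => if t = ioTape b then f (w t) else w t)

theorem runs_modifyTape {P : (Bool → ℕ → Bool) → Prop} (b : Bool) (f : Bool → Bool) {h : ℕ}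
    {cell : Tape → ℕ → Bool} (hP : P (io cell)) (hP' : P (modifyIO (io cell) b h f)) :
    ∃ cell', (modifyTape b f).Runs P ⟨h, cell⟩ (io cell b h) ⟨h, cell'⟩ ∧
      cell' .scratch = cell .scratch ∧ io cell' = modifyIO (io cell) b h f := by
  set cell' := putAt cell h fun t => if t = ioTape b then f (cell t h) else cell t h with hc
  have hs : cell' .scratch = cell .scratch := by
    cases b <;> simp [hc, putAt, ioTape]
  have hio : io cell' = modifyIO (io cell) b h f := by
    funext b'
    cases b <;> cases b' <;> simp [hc, putAt, ioTape, io, modifyIO]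
  exact ⟨cell', runs_modify _ hP (by rwa [← hio] at hP'), hs, hio⟩

/-- Reading and changing the bit on tape `b` at offset `j`, in the first block for
`far = false`, and in the block of the mark of register `0` for `far = true`. -/
def access (L : ℕ) (far : Bool) (b : Bool) (j : ℕ) (f : Bool → Bool) : Gadget Bool :=
  if far then
    (toMark L 0).andThen <| (moves .right j).andThen <| (modifyTape b f).bind fun x =>
      (moves .left j).andThen <| (moves .left L).andThen <| (toHome L 0).andThen <| nop x
  else (moves .right j).andThen <| (modifyTape b f).bind fun x =>
    (moves .left j).andThen <| nop x

/-- The mark of register `0` lies at the first cell of block `s 0 + 1`, so walking to that mark is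
the same as addressing this block on the memory tapes. -/
theorem runs_access {P : (Bool → ℕ → Bool) → Prop} {L : ℕ} (hL : 0 < L) (far b : Bool) (j : ℕ)
    (f : Bool → Bool) {s : ℕ → ℕ} {cell : Tape → ℕ → Bool} (hs : RegTape L s (cell .scratch))
    {k : ℕ} (hk : k = L * (if far then s 0 + 1 else 0) + j)
    (hP : P (io cell)) (hP' : P (modifyIO (io cell) b k f)) :
    ∃ cell', (access L far b j f).Runs P ⟨0, cell⟩ (io cell b k) ⟨0, cell'⟩ ∧
      RegTape L s (cell' .scratch) ∧ io cell' = modifyIO (io cell) b k f := by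
  obtain ⟨c1, r1, s1, i1⟩ := runs_modifyTape b f hP hP'
  refine ⟨c1, ?_, by rwa [s1], i1⟩
  have hP1 : P (io c1) := by rwa [i1]
  cases far with
  | false =>
    have hkj : k = 0 + j := by simpa using hk
    subst hkj
    exact runs_andThen (runs_moves_right j hP) (runs_bind r1
      (runs_andThen (runs_moves_left j hP1) (runs_nop _ hP1)))
  | true =>
    have hkj : k = L + 0 + s 0 * L + j := by
      rw [hk, if_pos rfl]; ring
    subst hkj
    refine runs_andThen (runs_toMark hL hs hP) (runs_andThen (runs_moves_right j hP)
      (runs_bind r1 (runs_andThen (runs_moves_left j hP1) ?_)))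
    rw [show L + 0 + s 0 * L = 0 + s 0 * L + L by ring]
    refine runs_andThen (runs_moves_left L hP1) (runs_andThen (runs_toHome (fun i hi => ?_) ?_ hP1)
      (runs_nop _ hP1))
    · rw [s1]; exact hs.zeros 0 hL i hi
    · rw [s1]; exact hs.base 0 hL

end Gadget

end ITTM

open Ordinal

namespace ITTM

/-! ### Limits of blocks of length `ω` -/

/-- The limsup at `o` of a sequence of bits is `1`. -/
def LimSup (a : Ordinal.{u} → Bool) (o : Ordinal.{u}) : Prop :=
  ∀ δ < o, ∃ γ < o, δ ≤ γ ∧ a γ = true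

theorem exists_block (γ : Ordinal.{u}) : ∃ (q : Ordinal.{u}) (n : ℕ), γ = ω * q + n := by
  obtain ⟨n, hn⟩ := lt_omega0.1 (mod_lt γ omega0_ne_zero)
  exact ⟨γ / ω, n, by rw [← hn, div_add_mod]⟩

theorem block_lt {q q' : Ordinal.{u}} (n : ℕ) (h : q < q') : ω * q + n < ω * q' := by
  have h1 : ω * q + n < ω * q + ω := by
    simp
  refine h1.trans_le ?_
  rw [← mul_add_one]
  exact mul_le_mul_right (Order.add_one_le_of_lt h) _

theorem lt_of_block_lt {q q' : Ordinal.{u}} {n : ℕ} (h : ω * q + n < ω * q') : q < q' := by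
  by_contra! hq
  exact absurd h (not_lt.2 ((mul_le_mul_right hq _).trans le_self_add))

theorem isSuccLimit_block {q : Ordinal.{u}} (hq : q ≠ 0) : Order.IsSuccLimit (ω * q) :=
  isSuccLimit_mul_left isSuccLimit_omega0 (pos_iff_ne_zero.2 hq)

/-- If `q` is a limit, it only matters in which blocks a `1` occurs (`h1`). If `q` is a successor,
it only matters whether `1` occurs infinitely often in the last block (`h2`). -/
theorem LimSup.of_blocks {a b : Ordinal.{u} → Bool} {q : Ordinal.{u}}
    (h1 : ∀ q' < q, (∃ n : ℕ, a (ω * q' + n) = true) → ∃ n : ℕ, b (ω * q' + n) = true)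
    (h2 : ∀ q' < q, (∀ m : ℕ, ∃ n ≥ m, a (ω * q' + n) = true) →
      ∀ m : ℕ, ∃ n ≥ m, b (ω * q' + n) = true)
    (h : LimSup a (ω * q)) : LimSup b (ω * q) := by
  intro δ hδ
  rcases zero_or_succ_or_isSuccLimit q with rfl | ⟨r, rfl⟩ | hq
  · simp at hδ
  · rw [mul_succ] at *
    have hr : r < Order.succ r := Order.lt_succ r
    have hinf : ∀ m : ℕ, ∃ n ≥ m, a (ω * r + n) = true := by
      intro m
      obtain ⟨γ, hγ, hm, ha⟩ := h (ω * r + m) (by simp)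
      obtain ⟨ε, rfl⟩ := le_iff_exists_add.1 (le_self_add.trans hm)
      obtain ⟨n, rfl⟩ := lt_omega0.1 ((add_lt_add_iff_left _).1 hγ)
      exact ⟨n, by simpa using hm, ha⟩
    obtain ⟨ε, hε, hδε⟩ := (lt_add_iff omega0_ne_zero).1 hδ
    obtain ⟨m, rfl⟩ := lt_omega0.1 hε
    obtain ⟨n, hn, hb⟩ := h2 r hr hinf m
    exact ⟨ω * r + n, by simp,
      hδε.trans (by simpa using hn), hb⟩
  · obtain ⟨q', hq', hδq⟩ := (lt_mul_iff_of_isSuccLimit hq).1 hδ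
    obtain ⟨γ, hγ, hle, ha⟩ := h (ω * q') (by simpa using block_lt 0 hq')
    obtain ⟨q'', n, rfl⟩ := exists_block γ
    have hq'' := lt_of_block_lt hγ
    obtain ⟨k, hb⟩ := h1 q'' hq'' ⟨n, ha⟩
    refine ⟨_, block_lt k hq'', ?_, hb⟩
    have : q' ≤ q'' := by
      by_contra! hlt
      exact absurd hle (not_le.2 (block_lt n hlt))
    exact hδq.le.trans ((mul_le_mul_right this _).trans le_self_add)

theorem limSup_congr_blocks {a b : Ordinal.{u} → Bool} {q : Ordinal.{u}}
    (h1 : ∀ q' < q, (∃ n : ℕ, a (ω * q' + n) = true) ↔ ∃ n : ℕ, b (ω * q' + n) = true)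
    (h2 : ∀ q' < q, (∀ m : ℕ, ∃ n ≥ m, a (ω * q' + n) = true) ↔
      ∀ m : ℕ, ∃ n ≥ m, b (ω * q' + n) = true) :
    LimSup a (ω * q) ↔ LimSup b (ω * q) :=
  ⟨.of_blocks (fun q' h => (h1 q' h).1) fun q' h => (h2 q' h).1,
    .of_blocks (fun q' h => (h1 q' h).2) fun q' h => (h2 q' h).2⟩

theorem exists_between_times {τ : ℕ → ℕ} (hτ : StrictMono τ) {j : ℕ} (hj : τ 0 ≤ j) :
    ∃ k, τ k ≤ j ∧ j < τ (k + 1) := by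
  have hex : ∃ k, j < τ k := ⟨j + 1, (Nat.lt_succ_self j).trans_le (hτ.id_le (j + 1))⟩
  classical
  have hs := Nat.find_spec hex
  obtain ⟨k, hk⟩ := Nat.exists_eq_succ_of_ne_zero
    (show Nat.find hex ≠ 0 by intro h; rw [h] at hs; omega)
  exact ⟨k, not_lt.1 (Nat.find_min hex (by omega)), by rw [hk] at hs; exact hs⟩

/-- A slowed-down sequence of bits has the same values, and takes the value `1` infinitely often
if and only if the original sequence does. -/
theorem slowdown {a b : ℕ → Bool} {τ : ℕ → ℕ} (hτ : StrictMono τ) (h0 : ∀ j < τ 0, a j = b 0)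
    (h : ∀ k, a (τ k) = b k)
    (h1 : ∀ k j, τ k ≤ j → j < τ (k + 1) → a j = b k ∨ a j = b (k + 1)) :
    ((∃ j, a j = true) ↔ ∃ k, b k = true) ∧
      ((∀ m, ∃ j ≥ m, a j = true) ↔ ∀ m, ∃ k ≥ m, b k = true) := by
  refine ⟨⟨fun ⟨j, hj⟩ => ?_, fun ⟨k, hk⟩ => ⟨τ k, by rw [h, hk]⟩⟩, fun hi m => ?_, fun hi m => ?_⟩
  · by_cases hlt : j < τ 0
    · exact ⟨0, by rw [← h0 j hlt, hj]⟩
    · obtain ⟨k, hk1, hk2⟩ := exists_between_times hτ (not_lt.1 hlt)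
      rcases h1 k j hk1 hk2 with e | e
      · exact ⟨k, by rw [← e, hj]⟩
      · exact ⟨k + 1, by rw [← e, hj]⟩
  · obtain ⟨j, hj, ha⟩ := hi (τ m)
    obtain ⟨k, hk1, hk2⟩ := exists_between_times hτ ((hτ.monotone (Nat.zero_le m)).trans hj)
    have hmk : m < k + 1 := hτ.lt_iff_lt.1 (hj.trans_lt hk2)
    rcases h1 k j hk1 hk2 with e | e
    · exact ⟨k, by omega, by rw [← e, ha]⟩
    · exact ⟨k + 1, by omega, by rw [← e, ha]⟩
  · obtain ⟨k, hk, hb⟩ := hi m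
    exact ⟨τ k, hk.trans (hτ.id_le k), by rw [h, hb]⟩

/-- Times at which a sequence passes through prescribed sets. -/
theorem exists_times {X : Type*} (f : ℕ → X) (C R : ℕ → X → Prop) {n₀ : ℕ} (h0 : C 0 (f n₀))
    (hs : ∀ k n, C k (f n) → ∃ n' > n, C (k + 1) (f n') ∧ ∀ j, n ≤ j → j < n' → R k (f j)) :
    ∃ τ : ℕ → ℕ, τ 0 = n₀ ∧ StrictMono τ ∧ (∀ k, C k (f (τ k))) ∧
      ∀ k j, τ k ≤ j → j < τ (k + 1) → R k (f j) := by
  choose g hg1 hg2 hg3 using hs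
  let t : ∀ k, {n // C k (f n)} := fun k =>
    Nat.rec ⟨n₀, h0⟩ (fun k n => ⟨g k n.1 n.2, hg2 k n.1 n.2⟩) k
  exact ⟨fun k => (t k).1, rfl, strictMono_nat_of_lt_succ fun k => hg1 k _ (t k).2,
    fun k => (t k).2, fun k j => hg3 k _ (t k).2 j⟩

/-! ### Computations of programs -/

theorem Program.run_limit_cell (p : Program) (x : ℕ → Bool) {o : Ordinal.{u}}
    (ho : Order.IsSuccLimit o) (t : Tape) (k : ℕ) :
    (p.run x o).cell t k = true ↔ LimSup (fun γ => (p.run x γ).cell t k) o := by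
  rw [p.run_limit x ho]
  simp only [limitConfig, decide_eq_true_eq, LimSup]
  refine forall_congr' fun δ => forall_congr' fun _ => exists_congr fun γ => ?_
  exact ⟨fun ⟨a, b, c⟩ => ⟨a, b, c⟩, fun ⟨a, b, c⟩ => ⟨a, b, c⟩⟩

theorem Program.run_limit_state (p : Program) (x : ℕ → Bool) {o : Ordinal.{u}}
    (ho : Order.IsSuccLimit o) : (p.run x o).state = .limit := by
  rw [p.run_limit x ho]; rfl

theorem Program.run_limit_head (p : Program) (x : ℕ → Bool) {o : Ordinal.{u}}
    (ho : Order.IsSuccLimit o) : (p.run x o).head = 0 := by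
  rw [p.run_limit x ho]; rfl

theorem Program.run_add_nat (p : Program) (x : ℕ → Bool) (o : Ordinal.{u}) (n : ℕ) :
    p.run x (o + n) = p.step^[n] (p.run x o) := by
  induction n with
  | zero => simp
  | succ n ih =>
    rw [Nat.cast_add_one, ← add_assoc, p.run_add_one, ih, Function.iterate_succ_apply']

theorem Program.step_of_ne (p : Program) {c : Config p.numWork} (hc : c.state ≠ .halt) :
    p.step c = ⟨(p.next c.state fun t => c.cell t c.head).1,
      (p.next c.state fun t => c.cell t c.head).2.2.move c.head, fun t =>
      Function.update (c.cell t) c.head ((p.next c.state fun t => c.cell t c.head).2.1 t)⟩ :=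
  if_neg hc

/-- The configuration with the given state and tapes. -/
def TapeConfig.withState {n : ℕ} (c : TapeConfig) (s : State n) : Config n := ⟨s, c.head, c.cell⟩

theorem Program.step_withState (p : Program) {s : State p.numWork} (hs : s ≠ .halt)
    (c : TapeConfig) :
    p.step (c.withState s) =
      (c.put (p.next s c.bits).2.1 (p.next s c.bits).2.2).withState (p.next s c.bits).1 := by
  simp only [Program.step, TapeConfig.withState, hs, if_false]
  rfl

/-- At least one step leads from `c` to `c'`, and before each of these steps `P` holds of the input
and output tapes and the machine has not halted. -/
def Program.Reaches (p : Program) (P : (Bool → ℕ → Bool) → Prop) (c c' : Config p.numWork) :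
    Prop :=
  ∃ n > 0, p.step^[n] c = c' ∧
    ∀ j < n, P (io (p.step^[j] c).cell) ∧ (p.step^[j] c).state ≠ .halt

theorem Program.Reaches.single {p : Program} {P : (Bool → ℕ → Bool) → Prop}
    {c : Config p.numWork} (h1 : P (io c.cell)) (h2 : c.state ≠ .halt) :
    p.Reaches P c (p.step c) :=
  ⟨1, one_pos, rfl, fun j hj => by
    obtain rfl : j = 0 := by omega
    exact ⟨h1, h2⟩⟩

theorem Program.Reaches.trans {p : Program} {P : (Bool → ℕ → Bool) → Prop}
    {c c' c'' : Config p.numWork} (h : p.Reaches P c c') (h' : p.Reaches P c' c'') :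
    p.Reaches P c c'' := by
  obtain ⟨n, hn, e, hP⟩ := h
  obtain ⟨m, hm, e', hP'⟩ := h'
  refine ⟨m + n, by omega, by rw [Function.iterate_add_apply, e, e'], fun j hj => ?_⟩
  by_cases hjn : j < n
  · exact hP j hjn
  · have := hP' (j - n) (by omega)
    rw [← e, ← Function.iterate_add_apply, Nat.sub_add_cancel (not_lt.1 hjn)] at this
    exact this

/-- Executions of a table that is part of a program. -/
theorem Gadget.Exec.reaches {E : Type} {G : Gadget E} {P : (Bool → ℕ → Bool) → Prop} {p : Program}
    {emb : G.Q → State p.numWork} {ex : E → State p.numWork} (hemb : ∀ q, emb q ≠ .halt)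
    (hnext : ∀ q b, p.next (emb q) b = ((G.next q b).1.elim emb ex, (G.next q b).2))
    {q : G.Q} {c c' : TapeConfig} {e : E} (h : G.Exec P q c e c') (s : State p.numWork)
    (hs : s ≠ .halt) (hsq : p.next s c.bits = p.next (emb q) c.bits) :
    p.Reaches P (c.withState s) (c'.withState (ex e)) := by
  -- The first step may be made from another state `s` with the same transition as `emb q`: the
  -- states `start` and `limit` take the place of entry states in this way.
  induction h generalizing s with
  | @exit q c e w d hP hn =>
    have := Program.Reaches.single (c := c.withState s) hP hs
    rw [p.step_withState hs, hsq, hnext, hn] at this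
    exact this
  | @step q q' c c' e w d hP hn _ ih =>
    have := Program.Reaches.single (c := c.withState s) hP hs
    rw [p.step_withState hs, hsq, hnext, hn] at this
    exact this.trans (ih _ (hemb q') rfl)

/-! ### Machines with primitive recursive control -/

/-- A machine whose memory consists of blocks of bits indexed by `ι` and whose control has states
in `S`. In the state `s`, it reads and writes the block `0` and the block `addr s + 1`, and goes to
the state `next s v w`, where `v` and `w` are the contents of these blocks. The control is primitive
recursive. Two bits of the block `0` are singled out. -/
structure ControlMachine : Type 1 where
  ι : Type
  fin : Fintype ι
  dec : DecidableEq ι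
  flagA : ι
  flagB : ι
  flags_ne : flagB ≠ flagA
  S : Type
  prim : Primcodable S
  start : S
  limit : S
  addr : S → ℕ
  next : S → (ι → Bool) → (ι → Bool) → S
  out : S → (ι → Bool) → (ι → Bool) → Bool → ι → Bool
  addr_prim : Primrec addr
  next_prim : ∀ v w, Primrec fun s => next s v w
  out_prim : ∀ v w far i, Primrec fun s => out s v w far i

attribute [instance] ControlMachine.fin ControlMachine.dec ControlMachine.prim

namespace ControlMachine

variable (M : ControlMachine)

/-- The control state and the contents of the memory. -/
structure Conf : Type where
  state : M.S
  mem : ℕ → M.ι → Bool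

variable {M}

/-- One step. -/
def step (c : M.Conf) : M.Conf where
  state := M.next c.state (c.mem 0) (c.mem (M.addr c.state + 1))
  mem := Function.update
    (Function.update c.mem 0 (M.out c.state (c.mem 0) (c.mem (M.addr c.state + 1)) false))
    (M.addr c.state + 1) (M.out c.state (c.mem 0) (c.mem (M.addr c.state + 1)) true)

variable (M)

open Classical in
/-- The transfinite computation: at limit stages, the control is in the state `limit` and each bit
of the memory is the limsup of its earlier values. -/
noncomputable def run (o : Ordinal.{u}) : M.Conf :=
  Ordinal.limitRecOn (motive := fun _ => M.Conf) o
    ⟨M.start, fun _ _ => false⟩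
    (fun _ c => step c)
    (fun o _ c => ⟨M.limit, fun v i =>
      decide (∀ δ < o, ∃ γ, ∃ h : γ < o, δ ≤ γ ∧ (c γ h).mem v i = true)⟩)

theorem run_zero : M.run (0 : Ordinal.{u}) = ⟨M.start, fun _ _ => false⟩ := by
  simp [run]

theorem run_add_one (o : Ordinal.{u}) : M.run (o + 1) = step (M.run o) := by
  simp [run]

theorem run_limit_state {o : Ordinal.{u}} (ho : Order.IsSuccLimit o) :
    (M.run o).state = M.limit := by
  simp [run, limitRecOn_limit _ _ _ _ ho]

theorem run_limit_mem {o : Ordinal.{u}} (ho : Order.IsSuccLimit o) (v : ℕ) (i : M.ι) :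
    (M.run o).mem v i = true ↔ LimSup (fun γ => (M.run γ).mem v i) o := by
  rw [run, limitRecOn_limit _ _ _ _ ho]
  simp only [decide_eq_true_eq, LimSup]
  refine forall_congr' fun δ => forall_congr' fun _ => exists_congr fun γ => ?_
  exact ⟨fun ⟨a, b, c⟩ => ⟨a, b, c⟩, fun ⟨a, b, c⟩ => ⟨a, b, c⟩⟩

theorem run_add_nat_succ (o : Ordinal.{u}) (n : ℕ) :
    M.run (o + (n + 1 : ℕ)) = step (M.run (o + n)) := by
  rw [Nat.cast_add_one, ← add_assoc, run_add_one]

variable {M}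

/-- The condition for halting, which is tested at limit stages. -/
def Accepts (c : M.Conf) : Prop := c.mem 0 M.flagA = false ∧ c.mem 0 M.flagB = true

variable (M)

/-! ### The memory on the tapes -/

noncomputable section

/-- The tape and the offset in a block where the bit `i` is kept. -/
def pos (i : M.ι) : Bool × ℕ :=
  if i = M.flagA then (false, 0) else if i = M.flagB then (true, 0)
  else (false, Fintype.equivFin M.ι i + 1)

/-- A bound for the offsets. -/
def width : ℕ := Fintype.card M.ι + 1

theorem pos_lt (i : M.ι) : (M.pos i).2 < M.width := by
  unfold pos width
  split_ifs
  · simp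
  · simp
  · have := (Fintype.equivFin M.ι i).2
    simp only; omega

/-- Only the two flags have offset `0`, and they lie on different tapes. Hence both are under the
head when it is on the first cell. -/
theorem pos_injective : Function.Injective M.pos := by
  intro i j h
  unfold pos at h
  split_ifs at h with h1 h2 h3 h4 h5 h6 <;> simp_all
  exact (Fintype.equivFin M.ι).injective (Fin.ext h)

/-- The memory that is represented by the contents of the input and output tape. -/
def memOf (L : ℕ) (x : Bool → ℕ → Bool) : ℕ → M.ι → Bool :=
  fun v i => x (M.pos i).1 (L * v + (M.pos i).2)

variable {M}

theorem memOf_modifyIO {L : ℕ} (hL : M.width ≤ L) (x : Bool → ℕ → Bool) (v : ℕ) (i : M.ι)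
    (f : Bool → Bool) (v' : ℕ) (i' : M.ι) :
    M.memOf L (Gadget.modifyIO x (M.pos i).1 (L * v + (M.pos i).2) f) v' i' =
      if v' = v ∧ i' = i then f (M.memOf L x v i) else M.memOf L x v' i' := by
  unfold memOf Gadget.modifyIO
  split_ifs with h
  · obtain ⟨rfl, rfl⟩ := h
    simp
  · by_cases h1 : (M.pos i').1 = (M.pos i).1
    · rw [h1, Function.update_self, Function.update_of_ne]
      intro he
      have := block_eq ((M.pos_lt i').trans_le hL) ((M.pos_lt i).trans_le hL) he
      exact h ⟨this.1, M.pos_injective (Prod.ext h1 this.2)⟩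
    · rw [Function.update_of_ne h1]

theorem modifyIO_id (x : Bool → ℕ → Bool) (b : Bool) (k : ℕ) :
    Gadget.modifyIO x b k id = x := by
  simp [Gadget.modifyIO]

/-- The two blocks that are accessed, when register `0` is `a`. -/
def blk (a : ℕ) (far : Bool) : ℕ := if far then a + 1 else 0

/-! ### One step of the machine on the tapes -/

open Gadget

variable (M)

/-- Reading the bits in the list `l`. -/
def readList (L : ℕ) (far : Bool) : List M.ι → (M.ι → Bool) → Gadget (M.ι → Bool)
  | [], acc => nop acc
  | i :: l, acc => (access L far (M.pos i).1 (M.pos i).2 id).bind fun x =>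
      readList L far l (Function.update acc i x)

variable {M}

theorem runs_readList {P : (Bool → ℕ → Bool) → Prop} {L : ℕ} (hL : M.width ≤ L) (far : Bool)
    {s : ℕ → ℕ} (l : List M.ι) (acc : M.ι → Bool) {cell : Tape → ℕ → Bool}
    (hs : RegTape L s (cell .scratch)) (hP : P (io cell)) :
    ∃ cell', (M.readList L far l acc).Runs P ⟨0, cell⟩
        (fun i => if i ∈ l then M.memOf L (io cell) (blk (s 0) far) i else acc i) ⟨0, cell'⟩ ∧
      RegTape L s (cell' .scratch) ∧ io cell' = io cell := by
  induction l generalizing acc cell with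
  | nil => exact ⟨cell, runs_nop acc hP, hs, rfl⟩
  | cons i l ih =>
    have hL0 : 0 < L := by unfold width at hL; omega
    obtain ⟨c1, r1, s1, i1⟩ := runs_access hL0 far (M.pos i).1 (M.pos i).2 id hs rfl hP
      (by rwa [modifyIO_id])
    rw [modifyIO_id] at i1
    set x := io cell (M.pos i).1 (L * (if far then s 0 + 1 else 0) + (M.pos i).2) with hx
    obtain ⟨c2, r2, s2, i2⟩ := ih (Function.update acc i x) s1 (by rwa [i1])
    refine ⟨c2, ?_, s2, by rw [i2, i1]⟩
    have e : (fun j => if j ∈ l then M.memOf L (io c1) (blk (s 0) far) j else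
        Function.update acc i x j) =
        fun j => if j ∈ i :: l then M.memOf L (io cell) (blk (s 0) far) j else acc j := by
      funext j
      rw [i1]
      by_cases hj : j = i
      · subst hj
        simp [hx, memOf, blk]
      · simp [hj]
    rw [e] at r2
    exact runs_bind r1 r2

variable (M)

/-- Register programs for the functions that control the machine, where register `0` holds the
address, register `1` the state and register `2` a bit. -/
structure Control : Type where
  addr : Cmd
  next : (M.ι → Bool) → (M.ι → Bool) → Cmd
  out : (M.ι → Bool) → (M.ι → Bool) → Bool → M.ι → Cmd
  const : M.S → Cmd
  addr_spec : ∀ (s : ℕ → ℕ) (σ : M.S), s 1 = Encodable.encode σ →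
    ∃ s', addr.Eval s s' ∧ s' 0 = M.addr σ ∧ s' 1 = Encodable.encode σ
  next_spec : ∀ v w (s : ℕ → ℕ) (σ : M.S), s 1 = Encodable.encode σ →
    ∃ s', (next v w).Eval s s' ∧ s' 1 = Encodable.encode (M.next σ v w)
  out_spec : ∀ v w far i (s : ℕ → ℕ) (σ : M.S), s 1 = Encodable.encode σ →
    ∃ s', (out v w far i).Eval s s' ∧ s' 2 = (M.out σ v w far i).toNat ∧ s' 0 = s 0 ∧ s' 1 = s 1
  const_spec : ∀ (σ : M.S) (s : ℕ → ℕ), ∃ s', (const σ).Eval s s' ∧ s' 1 = Encodable.encode σ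

/-- States are passed to register programs as their codes; the default for numbers that are not
codes never matters. -/
theorem exists_cmd {g : M.S → ℕ} (hg : Primrec g) {out : ℕ} (ho : out < 3) :
    ∃ c : Cmd, ∀ (s : ℕ → ℕ) (σ : M.S), s 1 = Encodable.encode σ →
      ∃ s', c.Eval s s' ∧ s' out = g σ ∧ ∀ r < 3, r ≠ out → s' r = s r := by
  have hf : Primrec fun n : ℕ => g ((Encodable.decode (α := M.S) n).getD M.start) :=
    hg.comp (Primrec.option_getD.comp Primrec.decode (.const _))
  obtain ⟨c, hc⟩ := Cmd.exists_computes_nat hf (x := 1) (b := 3) (by omega) ho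
  refine ⟨c, fun s σ hs => ?_⟩
  obtain ⟨s', h1, h2, h3⟩ := hc s
  exact ⟨s', h1, by simpa [hs] using h2, h3⟩

/-- The block contents `v` and `w` range over finite sets and can be kept in the finite control.
Only the state is input to the register programs, so one program for each choice of `v` and `w` is
enough. -/
theorem nonempty_control : Nonempty M.Control := by
  obtain ⟨ca, ha⟩ := M.exists_cmd M.addr_prim (out := 0) (by omega)
  choose cn hn using fun v w => M.exists_cmd (Primrec.encode.comp (M.next_prim v w)) (out := 1)
    (by omega)
  choose co ho using fun v w far i => M.exists_cmd
    ((Primrec.dom_finite Bool.toNat).comp (M.out_prim v w far i)) (out := 2) (by omega)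
  choose cc hc using fun σ : M.S => Cmd.exists_computes_nat
    (Primrec.const (α := ℕ) (Encodable.encode σ)) (x := 1) (out := 1) (b := 3)
    (by omega) (by omega)
  refine ⟨⟨ca, cn, co, cc, fun s σ hs => ?_, fun v w s σ hs => ?_, fun v w far i s σ hs => ?_,
    fun σ s => ?_⟩⟩
  · obtain ⟨s', h1, h2, h3⟩ := ha s σ hs
    exact ⟨s', h1, h2, by rw [h3 1 (by omega) (by omega), hs]⟩
  · obtain ⟨s', h1, h2, _⟩ := hn v w s σ hs
    exact ⟨s', h1, h2⟩
  · obtain ⟨s', h1, h2, h3⟩ := ho v w far i s σ hs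
    exact ⟨s', h1, h2, h3 0 (by omega) (by omega), h3 1 (by omega) (by omega)⟩
  · obtain ⟨s', h1, h2, _⟩ := hc σ s
    exact ⟨s', h1, h2⟩

variable {M}

/-- The length `L` of the blocks is large enough. -/
structure Control.Fits (C : M.Control) (L : ℕ) : Prop where
  width : M.width ≤ L
  three : 3 ≤ L
  addr : C.addr.regBound ≤ L
  next : ∀ v w, (C.next v w).regBound ≤ L
  out : ∀ v w far i, (C.out v w far i).regBound ≤ L
  start : (C.const M.start).regBound ≤ L
  limit : (C.const M.limit).regBound ≤ L

theorem Control.exists_fits (C : M.Control) : ∃ L, C.Fits L := by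
  obtain ⟨a, ha⟩ := Finite.exists_le fun x : (M.ι → Bool) × (M.ι → Bool) =>
    (C.next x.1 x.2).regBound
  obtain ⟨b, hb⟩ := Finite.exists_le fun x : (M.ι → Bool) × (M.ι → Bool) × Bool × M.ι =>
    (C.out x.1 x.2.1 x.2.2.1 x.2.2.2).regBound
  refine ⟨M.width + 3 + C.addr.regBound + a + b + (C.const M.start).regBound +
    (C.const M.limit).regBound, by omega, by omega, by omega, fun v w => ?_, fun v w far i => ?_,
    by omega, by omega⟩
  · have := ha (v, w); simp only at this; omega
  · have := hb (v, w, far, i); simp only at this; omega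

/-- Writing the bits in the list `l`. -/
def Control.writeList (C : M.Control) (L : ℕ) (v w : M.ι → Bool) :
    List (Bool × M.ι) → Gadget Unit
  | [] => nop ()
  | x :: l => ((C.out v w x.1 x.2).gadget L).andThen <| (decReg L 2).bind fun b =>
      (access L x.1 (M.pos x.2).1 (M.pos x.2).2 fun _ => b).bind fun _ => writeList C L v w l

/-- Each bit of the memory on the tapes `x` is as in `m` or as in `m'`. -/
def Between (L : ℕ) (m m' : ℕ → M.ι → Bool) (x : Bool → ℕ → Bool) : Prop :=
  ∀ v i, M.memOf L x v i = m v i ∨ M.memOf L x v i = m' v i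

/-- Each new bit is computed on the scratch tape from `v` and `w`, which are remembered by the
finite control, and then put in place by a single write. So a memory bit never has a value other
than its old and its new one. -/
theorem Control.runs_writeList {C : M.Control} {L : ℕ} (hL : C.Fits L) {m m' : ℕ → M.ι → Bool}
    {v w : M.ι → Bool} {σ : M.S} {a : ℕ}
    (hm' : ∀ far i, m' (blk a far) i = M.out σ v w far i) (l : List (Bool × M.ι)) {s : ℕ → ℕ}
    {cell : Tape → ℕ → Bool} (hs : RegTape L s (cell .scratch)) (h0 : s 0 = a)
    (h1 : s 1 = Encodable.encode σ) (hP : Between L m m' (io cell)) :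
    ∃ s' cell', (C.writeList L v w l).Runs (Between L m m') ⟨0, cell⟩ () ⟨0, cell'⟩ ∧
      RegTape L s' (cell' .scratch) ∧ s' 1 = Encodable.encode σ ∧ Between L m m' (io cell') ∧
      ∀ v i, M.memOf L (io cell') v i = m' v i ∨
        (M.memOf L (io cell') v i = M.memOf L (io cell) v i ∧ ∀ far, v = blk a far → (far, i) ∉ l) := by
  induction l generalizing s cell with
  | nil => exact ⟨s, cell, runs_nop _ hP, hs, h1, hP, fun v i => .inr ⟨rfl, by simp⟩⟩
  | cons y l ih =>
    obtain ⟨far, i⟩ := y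
    obtain ⟨s1, e1, o1, a1, b1⟩ := C.out_spec v w far i s σ h1
    obtain ⟨c1, r1, t1, i1⟩ := e1.runs (hL.out v w far i) hs hP
    -- Testing register `2` by a decrement turns the computed bit into an exit of the table. This
    -- may change register `2`, but the address and the state survive.
    have hdec : ∃ s2 cell2, (decReg L 2).Runs (Between L m m') ⟨0, c1⟩ (M.out σ v w far i)
        ⟨0, cell2⟩ ∧ RegTape L s2 (cell2 .scratch) ∧ io cell2 = io c1 ∧ s2 0 = a ∧
        s2 1 = Encodable.encode σ := by
      have hL3 := hL.three
      cases hb : M.out σ v w far i with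
      | false =>
        exact ⟨s1, c1, runs_decReg_zero (by omega) t1 (by rwa [i1]) (by rw [o1, hb]; rfl), t1,
          rfl, by rw [a1, h0], by rw [b1, h1]⟩
      | true =>
        obtain ⟨c2, r2, t2, i2⟩ := runs_decReg_succ (P := Between L m m') (r := 2) (k := 0)
          (by omega) t1 (by rwa [i1]) (by rw [o1, hb]; rfl)
        exact ⟨_, c2, r2, t2, i2, by simp [a1, h0], by simp [b1, h1]⟩
    obtain ⟨s2, c2, r2, t2, i2, a2, b2⟩ := hdec
    have hk : L * (if far then s2 0 + 1 else 0) + (M.pos i).2 = L * blk a far + (M.pos i).2 := by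
      rw [a2]; rfl
    have hmem : ∀ v' i', M.memOf L (modifyIO (io c2) (M.pos i).1
        (L * blk a far + (M.pos i).2) fun _ => M.out σ v w far i) v' i' =
        if v' = blk a far ∧ i' = i then m' v' i' else M.memOf L (io cell) v' i' := by
      intro v' i'
      rw [memOf_modifyIO hL.width, i2, i1]
      split_ifs with h
      · rw [h.1, h.2, hm']
      · rfl
    have hP3 : Between L m m' (modifyIO (io c2) (M.pos i).1
        (L * blk a far + (M.pos i).2) fun _ => M.out σ v w far i) := by
      intro v' i'
      rw [hmem]
      split_ifs
      · exact .inr rfl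
      · exact hP v' i'
    have hL0 : 0 < L := by have := hL.three; omega
    obtain ⟨c3, r3, t3, i3⟩ := runs_access (P := Between L m m') hL0 far (M.pos i).1 (M.pos i).2
      (fun _ => M.out σ v w far i) t2 hk.symm (by rwa [i2, i1]) hP3
    obtain ⟨s4, c4, r4, t4, b4, P4, q4⟩ := ih t3 a2 b2 (by rwa [i3])
    refine ⟨s4, c4, runs_andThen r1 (runs_bind r2 (runs_bind r3 r4)), t4, b4, P4, fun v' i' => ?_⟩
    rcases q4 v' i' with h | ⟨h, h'⟩
    · exact .inl h
    · rw [i3, hmem] at h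
      split_ifs at h with hc
      · exact .inl h
      · refine .inr ⟨h, fun far' hv' hmem' => ?_⟩
        rcases List.mem_cons.1 hmem' with he | he
        · obtain ⟨rfl, rfl⟩ := Prod.mk.inj he
          exact hc ⟨hv', rfl⟩
        · exact h' far' hv' he

/-- One step of the machine. -/
def Control.body (C : M.Control) (L : ℕ) : Gadget Unit :=
  (C.addr.gadget L).andThen <|
  (M.readList L false Finset.univ.toList fun _ => false).bind fun v =>
  (M.readList L true Finset.univ.toList fun _ => false).bind fun w =>
  (C.writeList L v w Finset.univ.toList).andThen ((C.next v w).gadget L)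

/-- The tapes represent the configuration `c`. -/
def Holds (L : ℕ) (c : M.Conf) (cell : Tape → ℕ → Bool) : Prop :=
  ∃ s : ℕ → ℕ, RegTape L s (cell .scratch) ∧ s 1 = Encodable.encode c.state ∧
    M.memOf L (io cell) = c.mem

theorem step_mem_blk (c : M.Conf) (far : Bool) :
    (step c).mem (blk (M.addr c.state) far) =
      M.out c.state (c.mem 0) (c.mem (M.addr c.state + 1)) far := by
  cases far <;> simp [step, blk]

theorem step_mem_of_ne (c : M.Conf) {v : ℕ} (hv : ∀ far, v ≠ blk (M.addr c.state) far) :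
    (step c).mem v = c.mem v := by
  have h0 := hv false
  have h1 := hv true
  simp only [blk, if_true, Bool.false_eq_true, if_false] at h0 h1
  simp [step, h0, h1]

/-- The new state is computed last, since all bits to be written depend on the old one. -/
theorem Control.runs_body {C : M.Control} {L : ℕ} (hL : C.Fits L) {c : M.Conf}
    {cell : Tape → ℕ → Bool} (h : Holds L c cell) :
    ∃ cell', (C.body L).Runs (Between L c.mem (step c).mem) ⟨0, cell⟩ () ⟨0, cell'⟩ ∧
      Holds L (step c) cell' := by
  obtain ⟨s, hs, h1, hm⟩ := h
  set P := Between L c.mem (step c).mem with hPdef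
  have hP : P (io cell) := fun v i => .inl (by rw [hm])
  obtain ⟨s1, e1, a1, b1⟩ := C.addr_spec s c.state h1
  obtain ⟨c1, r1, t1, i1⟩ := e1.runs hL.addr hs hP
  obtain ⟨c2, r2, t2, i2⟩ := runs_readList (P := P) hL.width false Finset.univ.toList
    (fun _ => false) t1 (by rwa [i1])
  obtain ⟨c3, r3, t3, i3⟩ := runs_readList (P := P) hL.width true Finset.univ.toList
    (fun _ => false) t2 (by rwa [i2, i1])
  have hi3 : io c3 = io cell := by rw [i3, i2, i1]
  simp only [Finset.mem_toList, Finset.mem_univ, if_true, i1, i2, hm, a1] at r2 r3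
  obtain ⟨s4, c4, r4, t4, b4, P4, q4⟩ := C.runs_writeList hL (m := c.mem) (m' := (step c).mem)
    (fun far i => congrFun (step_mem_blk c far) i) Finset.univ.toList t3 a1 b1 (by rwa [hi3])
  obtain ⟨s5, e5, b5⟩ := C.next_spec (c.mem 0) (c.mem (M.addr c.state + 1)) s4 c.state b4
  obtain ⟨c5, r5, t5, i5⟩ := e5.runs (P := P) (hL.next _ _) t4 P4
  refine ⟨c5, runs_andThen r1 (runs_bind r2 (runs_bind r3 (runs_andThen r4 r5))), s5, t5, b5, ?_⟩
  rw [i5]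
  funext v i
  rcases q4 v i with h | ⟨h, h'⟩
  · exact h
  · rw [h, hi3, hm, step_mem_of_ne]
    exact fun far hv => h' far hv (by simp)

/-- Preparing the registers. -/
def Control.init (C : M.Control) (L : ℕ) (σ : M.S) : Gadget Unit :=
  (resetRegs L).andThen ((C.const σ).gadget L)

/-- This is how the simulation starts and how it recovers from a limit stage: the control state is
then a known constant, and setting up the registers leaves the memory untouched. -/
theorem Control.runs_init {C : M.Control} {L : ℕ} {c : M.Conf}
    (hL : (C.const c.state).regBound ≤ L) {cell : Tape → ℕ → Bool}
    (h : M.memOf L (io cell) = c.mem) :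
    ∃ cell', (C.init L c.state).Runs (fun x => M.memOf L x = c.mem) ⟨0, cell⟩ () ⟨0, cell'⟩ ∧
      Holds L c cell' := by
  obtain ⟨c1, r1, t1, i1⟩ := runs_resetRegs (P := fun x => M.memOf L x = c.mem) L h
  obtain ⟨s2, e2, b2⟩ := C.const_spec c.state fun _ => 0
  obtain ⟨c2, r2, t2, i2⟩ := e2.runs (P := fun x => M.memOf L x = c.mem) hL t1 (by rwa [i1])
  exact ⟨c2, runs_andThen r1 r2, s2, t2, b2, by rw [i2, i1, h]⟩

end

end ControlMachine

open Gadget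

noncomputable section

/-! ### Programs from open machines -/

/-- The states of three tables together. -/
abbrev Assembled (G₀ G₁ G₂ : Gadget Unit) : Type := G₀.Q ⊕ G₁.Q ⊕ G₂.Q

instance (G₀ G₁ G₂ : Gadget Unit) : Finite (Assembled G₀ G₁ G₂) := by
  have := G₀.fin
  have := G₁.fin
  have := G₂.fin
  infer_instance

/-- The states of three tables as states of a program. -/
def embState {G₀ G₁ G₂ : Gadget Unit} (q : Assembled G₀ G₁ G₂) :
    State (Nat.card (Assembled G₀ G₁ G₂)) :=
  .work (Finite.equivFin _ q)

theorem embState_ne_halt {G₀ G₁ G₂ : Gadget Unit} (q : Assembled G₀ G₁ G₂) :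
    embState q ≠ .halt := nofun

/-- A transition of a table as a transition of a program. -/
def Gadget.transition {n : ℕ} (G : Gadget Unit) (emb : G.Q → State n) (ex : State n) (q : G.Q)
    (b : Tape → Bool) : State n × (Tape → Bool) × Dir :=
  ((G.next q b).1.elim emb fun _ => ex, (G.next q b).2)

/-- The program which runs `G₀` at the start and `G₁` after each limit stage, and then repeats `G₂`
up to the next limit stage. It halts at a limit stage if the bits on the first cell of the
input and output tapes are `0` and `1`. -/
def assemble (G₀ G₁ G₂ : Gadget Unit) : Program where
  numWork := Nat.card (Assembled G₀ G₁ G₂)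
  next s b :=
    let ex : State (Nat.card (Assembled G₀ G₁ G₂)) := embState (.inr (.inr G₂.entry))
    match s with
    | .start => G₀.transition (fun q => embState (.inl q)) ex G₀.entry b
    | .limit =>
      if b .input = false ∧ b .output = true then (.halt, b, .left)
      else G₁.transition (fun q => embState (.inr (.inl q))) ex G₁.entry b
    | .halt => (.halt, b, .left)
    | .work i =>
      match (Finite.equivFin (Assembled G₀ G₁ G₂)).symm i with
      | .inl q => G₀.transition (fun q => embState (.inl q)) ex q b
      | .inr (.inl q) => G₁.transition (fun q => embState (.inr (.inl q))) ex q b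
      | .inr (.inr q) => G₂.transition (fun q => embState (.inr (.inr q))) ex q b

namespace ControlMachine

variable {M : ControlMachine}

/-- The program for the machine `M`. -/
def Control.program (C : M.Control) (L : ℕ) : Program :=
  assemble (C.init L M.start) (C.init L M.limit) (C.body L)

/-- The state in which a step of `M` is begun. -/
def Control.idle (C : M.Control) (L : ℕ) : State (C.program L).numWork :=
  embState (.inr (.inr (C.body L).entry))

theorem Control.reaches_init {C : M.Control} {L : ℕ} (hL : C.Fits L) {c : M.Conf}
    {cell : Tape → ℕ → Bool} (hm : M.memOf L (io cell) = c.mem)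
    {s : State (C.program L).numWork}
    (h : s = .start ∧ c.state = M.start ∨ s = .limit ∧ c.state = M.limit ∧ ¬ Accepts c) :
    ∃ cell', (C.program L).Reaches (fun x => M.memOf L x = c.mem)
      ((⟨0, cell⟩ : TapeConfig).withState s) ((⟨0, cell'⟩ : TapeConfig).withState (C.idle L)) ∧
      Holds L c cell' := by
  rcases h with ⟨rfl, hs⟩ | ⟨rfl, hs, hacc⟩
  · obtain ⟨c1, r1, h1⟩ := C.runs_init (c := c) (by rw [hs]; exact hL.start) hm
    rw [hs] at r1
    refine ⟨c1, ?_, h1⟩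
    refine Exec.reaches (G := C.init L M.start) (p := C.program L)
      (emb := fun q => embState (.inl q)) (ex := fun _ => C.idle L)
      (fun q => embState_ne_halt _) (fun q b => ?_) r1 _ (by simp) ?_
    · simp only [Control.program, assemble, embState, Equiv.symm_apply_apply]
      rfl
    · simp only [Control.program, assemble, embState, Equiv.symm_apply_apply]
  · obtain ⟨c1, r1, h1⟩ := C.runs_init (c := c) (by rw [hs]; exact hL.limit) hm
    rw [hs] at r1
    refine ⟨c1, ?_, h1⟩
    refine Exec.reaches (G := C.init L M.limit) (p := C.program L)
      (emb := fun q => embState (.inr (.inl q))) (ex := fun _ => C.idle L)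
      (fun q => embState_ne_halt _) (fun q b => ?_) r1 _ (by simp) ?_
    · simp only [Control.program, assemble, embState, Equiv.symm_apply_apply]
      rfl
    · have hA : cell .input 0 = c.mem 0 M.flagA := by
        rw [← hm]; simp [memOf, pos, io, ioTape]
      have hB : cell .output 0 = c.mem 0 M.flagB := by
        rw [← hm]; simp [memOf, pos, io, ioTape, M.flags_ne]
      have hno : ¬ ((TapeConfig.bits ⟨0, cell⟩) .input = false ∧
          (TapeConfig.bits ⟨0, cell⟩) .output = true) := by
        simp only [TapeConfig.bits, hA, hB]
        exact hacc
      simp only [Control.program, assemble, embState, Equiv.symm_apply_apply, if_neg hno]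

theorem Control.reaches_body {C : M.Control} {L : ℕ} (hL : C.Fits L) {c : M.Conf}
    {cell : Tape → ℕ → Bool} (h : Holds L c cell) :
    ∃ cell', (C.program L).Reaches (Between L c.mem (step c).mem)
      ((⟨0, cell⟩ : TapeConfig).withState (C.idle L))
      ((⟨0, cell'⟩ : TapeConfig).withState (C.idle L)) ∧ Holds L (step c) cell' := by
  obtain ⟨c1, r1, h1⟩ := C.runs_body hL h
  refine ⟨c1, ?_, h1⟩
  refine Exec.reaches (G := C.body L) (p := C.program L)
    (emb := fun q => embState (.inr (.inr q))) (ex := fun _ => C.idle L)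
    (fun q => embState_ne_halt _) (fun q b => ?_) r1 _ (embState_ne_halt _) rfl
  simp only [Control.program, assemble, embState, Equiv.symm_apply_apply]
  rfl

/-- The computation of the program between two limit stages. -/
theorem Control.block {C : M.Control} {L : ℕ} (hL : C.Fits L) (x : ℕ → Bool) {o : Ordinal.{u}}
    (hm : M.memOf L (io ((C.program L).run x o).cell) = (M.run o).mem)
    (hh : ((C.program L).run x o).head = 0)
    (h : ((C.program L).run x o).state = .start ∧ (M.run o).state = M.start ∨
      ((C.program L).run x o).state = .limit ∧ (M.run o).state = M.limit ∧ ¬ Accepts (M.run o)) :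
    (∀ n : ℕ, ((C.program L).run x (o + n)).state ≠ .halt) ∧ ∀ v i,
      ((∃ n : ℕ, M.memOf L (io ((C.program L).run x (o + n)).cell) v i = true) ↔
        ∃ n : ℕ, (M.run (o + n)).mem v i = true) ∧
      ((∀ m, ∃ n : ℕ, n ≥ m ∧ M.memOf L (io ((C.program L).run x (o + n)).cell) v i = true) ↔
        ∀ m, ∃ n : ℕ, n ≥ m ∧ (M.run (o + n)).mem v i = true) := by
  set f : ℕ → Config (C.program L).numWork := fun j => (C.program L).run x (o + j) with hf
  have hfj : ∀ n j, (C.program L).step^[j] (f n) = f (n + j) := by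
    intro n j
    simp only [hf, Program.run_add_nat]
    rw [← Function.iterate_add_apply, add_comm]
  have hf0 : f 0 = (⟨0, ((C.program L).run x o).cell⟩ : TapeConfig).withState
      ((C.program L).run x o).state := by
    rw [show f 0 = (C.program L).run x o by simp [hf]]
    revert hh
    generalize (C.program L).run x o = c
    cases c
    rintro rfl
    rfl
  obtain ⟨c1, ⟨n₀, _, e0, P0⟩, h1⟩ := C.reaches_init hL hm h
  rw [← hf0, hfj, zero_add] at e0
  simp only [← hf0, hfj, zero_add] at P0
  -- `τ k` is the number of tape steps after which step `k` of the machine begins in this block;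
  -- before `τ 0 = n₀` the registers are set up and the memory is constant.
  obtain ⟨τ, hτ0, hτ, hC, hR⟩ := exists_times f
    (fun k y => ∃ cell, y = (⟨0, cell⟩ : TapeConfig).withState (C.idle L) ∧
      Holds L (M.run (o + k)) cell)
    (fun k y => Between L (M.run (o + k)).mem (M.run (o + (k + 1 : ℕ))).mem (io y.cell) ∧
      y.state ≠ .halt) (n₀ := n₀)
    ⟨c1, e0, by simpa using h1⟩
    (by
      rintro k n ⟨cell, hy, hcell⟩
      obtain ⟨c2, ⟨m, hm0, e2, P2⟩, h2⟩ := C.reaches_body hL hcell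
      rw [← hy, hfj] at e2
      simp only [← hy, hfj] at P2
      refine ⟨n + m, by omega, ⟨c2, e2, by rwa [run_add_nat_succ]⟩, fun j hj hj' => ?_⟩
      have := P2 (j - n) (by omega)
      rw [Nat.add_sub_cancel' hj] at this
      rwa [run_add_nat_succ])
  refine ⟨fun n => ?_, fun v i => ?_⟩
  · by_cases hn : n < n₀
    · exact (P0 n hn).2
    · obtain ⟨k, hk1, hk2⟩ := exists_between_times hτ (j := n) (by omega)
      exact (hR k n hk1 hk2).2
  · refine slowdown (a := fun j => M.memOf L (io (f j).cell) v i)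
      (b := fun k => (M.run (o + k)).mem v i) hτ (fun j hj => ?_) (fun k => ?_)
      (fun k j h1 h2 => (hR k j h1 h2).1 v i)
    · have := (P0 j (by omega)).1
      simp only [this, Nat.cast_zero, add_zero]
    · obtain ⟨cell, hy, s, _, _, hmem⟩ := hC k
      rw [hy]
      exact congrFun (congrFun hmem v) i

/-- The first limit stage at which a machine with primitive recursive control accepts is
clockable. -/
theorem clockable {q : Ordinal.{u}} (hq : q ≠ 0) (hacc : Accepts (M.run (ω * q)))
    (hmin : ∀ q' < q, q' ≠ 0 → ¬ Accepts (M.run (ω * q'))) : Clockable (ω * q) := by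
  obtain ⟨C⟩ := M.nonempty_control
  obtain ⟨L, hL⟩ := C.exists_fits
  set p := C.program L with hp
  set x : ℕ → Bool := fun _ => false with hx
  have hstart : ∀ q' ≤ q, (p.run x (ω * q')).head = 0 ∧
      (q' = 0 ∧ (p.run x (ω * q')).state = .start ∧ (M.run (ω * q')).state = M.start ∨
        q' ≠ 0 ∧ (p.run x (ω * q')).state = .limit ∧ (M.run (ω * q')).state = M.limit) := by
    intro q' _
    by_cases h0 : q' = 0
    · subst h0
      simp [Program.run_zero, run_zero, initial]
    · have hl := isSuccLimit_block h0
      exact ⟨p.run_limit_head x hl, .inr ⟨h0, p.run_limit_state x hl, M.run_limit_state hl⟩⟩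
  have hblock : ∀ q' < q, M.memOf L (io (p.run x (ω * q')).cell) = (M.run (ω * q')).mem →
      _ := fun q' hq' hm => C.block hL x hm (hstart q' hq'.le).1 (by
        rcases (hstart q' hq'.le).2 with ⟨_, h1, h2⟩ | ⟨h0, h1, h2⟩
        · exact .inl ⟨h1, h2⟩
        · exact .inr ⟨h1, h2, hmin q' hq' h0⟩)
  -- By `hblock`, in every earlier block the tapes and the memory show a `1` at all, or infinitely
  -- often, in the same places; this is all that a limsup at a multiple of `ω` depends on.
  have hmem : ∀ q' ≤ q, M.memOf L (io (p.run x (ω * q')).cell) = (M.run (ω * q')).mem := by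
    intro q'
    induction q' using WellFoundedLT.induction with
    | ind q' ih =>
      intro hq'
      by_cases h0 : q' = 0
      · subst h0
        funext v i
        simp only [mul_zero, Program.run_zero, run_zero, memOf, io]
        cases (M.pos i).1 <;> rfl
      · have hl := isSuccLimit_block h0
        funext v i
        rw [Bool.eq_iff_iff, M.run_limit_mem hl]
        refine (p.run_limit_cell x hl _ _).trans ?_
        refine limSup_congr_blocks (fun r hr => ?_) (fun r hr => ?_)
        · exact ((hblock r (hr.trans_le hq') (ih r hr (hr.le.trans hq'))).2 v i).1
        · exact ((hblock r (hr.trans_le hq') (ih r hr (hr.le.trans hq'))).2 v i).2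
  refine ⟨p, fun γ hγ => ?_, ?_⟩
  · rcases hγ.lt_or_eq with hlt | rfl
    · obtain ⟨q', n, rfl⟩ := exists_block γ
      have hq' := lt_of_block_lt hlt
      exact (hblock q' hq' (hmem q' hq'.le)).1 n
    · rw [p.run_limit_state _ (isSuccLimit_block hq)]
      simp
  · have hl := isSuccLimit_block hq
    have hm := hmem q le_rfl
    have hs := p.run_limit_state x hl
    have hh := p.run_limit_head x hl
    rw [Program.run_add_one]
    set c := p.run x (ω * q) with hc
    have hA : c.cell .input 0 = false := by
      rw [← hacc.1, ← hm]; simp [memOf, pos, io, ioTape]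
    have hB : c.cell .output 0 = true := by
      rw [← hacc.2, ← hm]; simp [memOf, pos, io, ioTape, M.flags_ne]
    have hne : c.state ≠ .halt := by rw [hs]; simp
    simp only [Program.step, if_neg hne]
    rw [hs, hh]
    -- Both flags are under the head at the limit stage, so the very next step leads to the halt
    -- state.
    have : p.next .limit (fun t => c.cell t 0) = (.halt, (fun t => c.cell t 0), .left) :=
      if_pos ⟨hA, hB⟩
    rw [this]

end ControlMachine

end

/-! ### Successors of clockable ordinals -/

/-- A new state in front of the halt state. -/
def State.lift {n : ℕ} : State n → State (n + 1)
  | .start => .start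
  | .limit => .limit
  | .halt => .work (Fin.last n)
  | .work i => .work i.castSucc

/-- The transition with its new state lifted. -/
def liftTransition {n : ℕ} (r : State n × (Tape → Bool) × Dir) :
    State (n + 1) × (Tape → Bool) × Dir :=
  (r.1.lift, r.2)

/-- The program that makes one more step before it halts. -/
def Program.delay (p : Program) : Program where
  numWork := p.numWork + 1
  next s b :=
    match s with
    | .start => liftTransition (p.next .start b)
    | .limit => liftTransition (p.next .limit b)
    | .halt => (.halt, b, .left)
    | .work i => Fin.lastCases (.halt, b, .left) (fun i => liftTransition (p.next (.work i) b)) i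

/-- The configuration with its state lifted. -/
def Program.liftConfig (p : Program) (c : Config p.numWork) : Config p.delay.numWork :=
  ⟨c.state.lift, c.head, c.cell⟩

theorem State.lift_ne_halt {n : ℕ} (s : State n) : s.lift ≠ .halt := by
  cases s <;> exact nofun

theorem Program.delay_next (p : Program) {s : State p.numWork} (hs : s ≠ .halt)
    (b : Tape → Bool) : p.delay.next s.lift b = liftTransition (p.next s b) := by
  cases s with
  | start => rfl
  | limit => rfl
  | halt => exact absurd rfl hs
  | work i => simp [Program.delay, State.lift]

theorem Program.delay_step (p : Program) {c : Config p.numWork} (hc : c.state ≠ .halt) :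
    p.delay.step (p.liftConfig c) = p.liftConfig (p.step c) := by
  have h2 : p.delay.next (p.liftConfig c).state (fun t => c.cell t c.head) =
    liftTransition (p.next c.state fun t => c.cell t c.head) := p.delay_next hc _
  rw [p.delay.step_of_ne (State.lift_ne_halt _), p.step_of_ne hc]
  change (⟨_, _, _⟩ : Config p.delay.numWork) = _
  simp only [liftConfig] at h2 ⊢
  rw [h2]
  rfl

/-- The two programs agree up to and including the first stage at which `p` is in the halt state;
there `delay` is still in its extra state. -/
theorem Program.delay_run (p : Program) (x : ℕ → Bool) (γ : Ordinal.{u})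
    (h : ∀ δ < γ, (p.run x δ).state ≠ .halt) : p.delay.run x γ = p.liftConfig (p.run x γ) := by
  induction γ using Ordinal.limitRecOn with
  | zero => rw [Program.run_zero, Program.run_zero]; rfl
  | add_one γ ih =>
    rw [Program.run_add_one, Program.run_add_one,
      ih fun δ hδ => h δ (hδ.trans (Order.lt_add_one_iff.2 le_rfl)),
      p.delay_step (h γ (Order.lt_add_one_iff.2 le_rfl))]
  | limit γ hγ ih =>
    rw [p.delay.run_limit x hγ, p.run_limit x hγ]
    have : (fun (δ : Ordinal.{u}) (_ : δ < γ) => p.delay.run x δ) =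
        fun (δ : Ordinal.{u}) (_ : δ < γ) => p.liftConfig (p.run x δ) :=
      funext fun δ => funext fun hδ => ih δ hδ fun ε hε => h ε (hε.trans hδ)
    rw [this]
    rfl

theorem Clockable.add_one {α : Ordinal.{u}} (h : Clockable α) : Clockable (α + 1) := by
  obtain ⟨p, h1, h2⟩ := h
  have hle : ∀ γ ≤ α + 1, p.delay.run (fun _ => false) γ = p.liftConfig (p.run (fun _ => false) γ) :=
    fun γ hγ => p.delay_run _ γ fun δ hδ => h1 δ (Order.lt_add_one_iff.1 (hδ.trans_le hγ))
  refine ⟨p.delay, fun γ hγ => ?_, ?_⟩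
  · rw [hle γ hγ]
    exact State.lift_ne_halt _
  · rw [Program.run_add_one, hle _ le_rfl]
    rw [p.delay.step_of_ne (State.lift_ne_halt _)]
    simp [Program.liftConfig, h2, State.lift, Program.delay]

/-! ### Detecting a pattern at a limit stage -/

theorem limSup_congr {a b : Ordinal.{u} → Bool} {o : Ordinal.{u}} (h : ∀ γ < o, a γ = b γ) :
    LimSup a o ↔ LimSup b o := by
  refine forall_congr' fun δ => forall_congr' fun _ => exists_congr fun γ => ?_
  exact and_congr_right fun hγ => by rw [h γ hγ]

theorem not_limSup {a : Ordinal.{u} → Bool} {o : Ordinal.{u}} :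
    ¬ LimSup a o ↔ ∃ δ < o, ∀ γ < o, δ ≤ γ → a γ = false := by
  simp only [LimSup, not_forall, not_exists, not_and, Bool.not_eq_true, exists_prop]

/-- A family of finitely many ordinals below `o` has an upper bound below `o`. -/
theorem exists_bound {ι : Type*} [Finite ι] {o : Ordinal.{u}} (ho : 0 < o) (f : ι → Ordinal.{u})
    (hf : ∀ i, f i < o) : ∃ δ < o, ∀ i, f i ≤ δ := by
  have : Nonempty (Set.Iio o) := ⟨⟨0, ho⟩⟩
  obtain ⟨δ, hδ⟩ := Finite.exists_le fun i => (⟨f i, hf i⟩ : Set.Iio o)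
  exact ⟨δ.1, δ.2, hδ⟩

/-- Finiteness is what is needed from left to right: the finitely many bounds after which the single
events no longer happen have a common bound below `o`. -/
theorem limSup_exists {ι : Type*} [Finite ι] {a : ι → Ordinal.{u} → Bool} {e : Ordinal.{u} → Bool}
    {o : Ordinal.{u}} (ho : 0 < o) (he : ∀ γ < o, e γ = true ↔ ∃ i, a i γ = true) :
    LimSup e o ↔ ∃ i, LimSup (a i) o := by
  constructor
  · intro h
    by_contra hno
    simp only [not_exists, not_limSup] at hno
    choose f hf hf' using hno
    obtain ⟨δ, hδ, hle⟩ := exists_bound ho f hf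
    obtain ⟨γ, hγ, hδγ, hγe⟩ := h δ hδ
    obtain ⟨i, hi⟩ := (he γ hγ).1 hγe
    rw [hf' i γ hγ ((hle i).trans hδγ)] at hi
    exact Bool.noConfusion hi
  · rintro ⟨i, hi⟩ δ hδ
    obtain ⟨γ, hγ, hδγ, hγe⟩ := hi δ hδ
    exact ⟨γ, hγ, hδγ, (he γ hγ).2 ⟨i, hγe⟩⟩

/-- A bit that repeats the event `e` one step later has the same limsup. -/
theorem limSup_shift {a e : Ordinal.{u} → Bool} {o : Ordinal.{u}} (ho : Order.IsSuccLimit o)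
    (hs : ∀ γ < o, a (γ + 1) = e γ)
    (hl : ∀ γ < o, Order.IsSuccLimit γ → a γ = true → LimSup a γ) :
    LimSup a o ↔ LimSup e o := by
  constructor
  · intro h
    by_contra hno
    obtain ⟨δ, hδ, hδe⟩ := not_limSup.1 hno
    have key : ∀ γ < o, δ + 1 ≤ γ → a γ = false := by
      intro γ
      induction γ using Ordinal.limitRecOn with
      | zero => intro _ h0; simp at h0
      | add_one γ _ =>
        intro hγ hle
        have hγ' := (Order.lt_add_one_iff.2 le_rfl).trans hγ
        rw [hs γ hγ']
        exact hδe γ hγ' (by simpa using hle)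
      | limit γ hγl ih =>
        intro hγ hle
        by_contra ha
        rw [Bool.not_eq_false] at ha
        have hlt : δ + 1 < γ := hγl.add_one_lt (Order.add_one_le_iff.1 hle)
        obtain ⟨ε, hε, hle', hε'⟩ := hl γ hγ hγl ha (δ + 1) hlt
        rw [ih ε hε (hε.trans hγ) hle'] at hε'
        exact Bool.noConfusion hε'
    obtain ⟨γ, hγ, hle, ha⟩ := h (δ + 1) (ho.add_one_lt hδ)
    rw [key γ hγ hle] at ha
    exact Bool.noConfusion ha
  · intro h δ hδ
    obtain ⟨γ, hγ, hle, he⟩ := h δ hδ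
    exact ⟨γ + 1, ho.add_one_lt hγ, hle.trans (le_self_add), by rw [hs γ hγ, he]⟩

/-- A bit that is `1` whenever all events `e i` have happened, where the record `r i` of the event
`e i` is deleted at these stages, is `1` cofinally often if and only if every event happens
cofinally often. -/
theorem limSup_roundRobin {ι : Type*} [Finite ι] {b full : Ordinal.{u} → Bool}
    {r e : ι → Ordinal.{u} → Bool} {o : Ordinal.{u}} (ho : Order.IsSuccLimit o)
    (hfull : ∀ γ < o, full γ = true ↔ ∀ i, (r i γ || e i γ) = true)
    (hb : ∀ γ < o, b (γ + 1) = full γ)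
    (hr : ∀ γ < o, ∀ i, r i (γ + 1) = (!full γ && (r i γ || e i γ)))
    (hbl : ∀ γ < o, Order.IsSuccLimit γ → b γ = true → LimSup b γ)
    (hrl : ∀ γ < o, Order.IsSuccLimit γ → ∀ i, r i γ = true ↔ LimSup (r i) γ) :
    LimSup b o ↔ ∀ i, LimSup (e i) o := by
  have ho0 : 0 < o := ho.bot_lt
  rw [limSup_shift ho hb hbl]
  constructor
  · intro h i
    by_contra hno
    obtain ⟨δ, hδ, hδe⟩ := not_limSup.1 hno
    obtain ⟨γ₁, hγ₁, hle₁, hf₁⟩ := h δ hδ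
    -- The full stage `γ₁` deletes the record of event `i`, and since the event does not happen
    -- again, the record stays empty, also at limits. So there is no full stage after `γ₁`, a
    -- contradiction.
    have key : ∀ γ < o, γ₁ + 1 ≤ γ → r i γ = false := by
      intro γ
      induction γ using Ordinal.limitRecOn with
      | zero => intro _ h0; simp at h0
      | add_one γ ih =>
        intro hγ hle
        have hγ' := (Order.lt_add_one_iff.2 le_rfl).trans hγ
        have hle' : γ₁ ≤ γ := by simpa using hle
        rw [hr γ hγ' i]
        rcases hle'.eq_or_lt with rfl | hlt
        · simp [hf₁]
        · rw [ih hγ' (Order.add_one_le_of_lt hlt), hδe γ hγ' (hle₁.trans hle')]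
          simp
      | limit γ hγl ih =>
        intro hγ hle
        by_contra ha
        rw [Bool.not_eq_false] at ha
        have hlt : γ₁ + 1 < γ := hγl.add_one_lt (Order.add_one_le_iff.1 hle)
        obtain ⟨ε, hε, hle', hε'⟩ := (hrl γ hγ hγl i).1 ha (γ₁ + 1) hlt
        rw [ih ε hε (hε.trans hγ) hle'] at hε'
        exact Bool.noConfusion hε'
    obtain ⟨γ₂, hγ₂, hle₂, hf₂⟩ := h (γ₁ + 1) (ho.add_one_lt hγ₁)
    have := (hfull γ₂ hγ₂).1 hf₂ i
    rw [key γ₂ hγ₂ hle₂, hδe γ₂ hγ₂ ((hle₁.trans le_self_add).trans hle₂)] at this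
    exact Bool.noConfusion this
  · intro h
    by_contra hno
    obtain ⟨δ, hδ, hδf⟩ := not_limSup.1 hno
    -- Without full stages from `δ` on, no record is deleted. Once all events have happened after
    -- `δ`, all records are there together and the stage is full, a contradiction.
    have key : ∀ i, ∀ γ₀, δ ≤ γ₀ → r i γ₀ = true → ∀ γ < o, γ₀ ≤ γ → r i γ = true := by
      intro i γ₀ hδγ h0 γ
      induction γ using Ordinal.limitRecOn with
      | zero =>
        intro _ hle
        rwa [← nonpos_iff_eq_zero.1 hle]
      | add_one γ ih =>
        intro hγ hle
        rcases hle.eq_or_lt with rfl | hlt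
        · exact h0
        · have hγ' := (Order.lt_add_one_iff.2 le_rfl).trans hγ
          have hle' := Order.lt_add_one_iff.1 hlt
          rw [hr γ hγ' i, hδf γ hγ' (hδγ.trans hle'), ih hγ' hle']
          simp
      | limit γ hγl ih =>
        intro hγ hle
        rcases hle.eq_or_lt with rfl | hlt
        · exact h0
        · refine (hrl γ hγ hγl i).2 fun ε hε => ⟨max ε γ₀, max_lt hε hlt, le_max_left _ _, ?_⟩
          exact ih _ (max_lt hε hlt) ((max_lt hε hlt).trans hγ) (le_max_right _ _)
    choose g hg hδg hge using fun i => h i δ hδ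
    obtain ⟨η, hη, hle⟩ := exists_bound ho0 (fun i => g i + 1) fun i => ho.add_one_lt (hg i)
    have hm : max η δ < o := max_lt hη hδ
    have : full (max η δ) = true := by
      refine (hfull _ hm).2 fun i => ?_
      have h1 : r i (g i + 1) = true := by
        rw [hr _ (hg i), hδf _ (hg i) (hδg i), hge i]
        simp
      rw [key i (g i + 1) ((hδg i).trans le_self_add) h1 _ hm ((hle i).trans (le_max_left _ _))]
      simp
    rw [hδf _ hm (le_max_right _ _)] at this
    exact Bool.noConfusion this

/-! ### Speeding up by finitely many steps -/

instance : Fintype Tape := ⟨{.input, .scratch, .output}, fun t => by cases t <;> simp⟩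

instance (n : ℕ) : Finite (State n) :=
  Finite.of_injective (β := Option (Option (Option (Fin n))))
    (fun s => match s with
      | .start => none
      | .limit => some none
      | .halt => some (some none)
      | .work i => some (some (some i)))
    (fun s t h => by cases s <;> cases t <;> simp_all)

noncomputable instance (n : ℕ) : Primcodable (State n) :=
  Primcodable.ofEquiv (Fin (Nat.card (State n))) (Finite.equivFin _)

theorem Dir.move_eq (d : Dir) (h : ℕ) :
    d.move h = bif (match d with | .left => true | .right => false) then h - 1 else h + 1 := by
  cases d <;> rfl

theorem primrec_move {σ : Type} [Primcodable σ] {f : σ → Dir} {g : σ → ℕ}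
    (hf : Primrec fun s => (match f s with | .left => true | .right => false : Bool))
    (hg : Primrec g) : Primrec fun s => (f s).move (g s) := by
  simp only [Dir.move_eq]
  exact Primrec.cond hf (Primrec.pred.comp hg) (Primrec.succ.comp hg)

/-- The bits of a block of the machine `watch`: flags, the cells of the tapes, copies of the first
`N` cells, and a record of those that have been seen to be `1`. -/
abbrev WatchBit (N : ℕ) : Type := Bool ⊕ Tape ⊕ (Tape × Fin N) ⊕ (Tape × Fin N)

section

variable (p : Program) {N : ℕ} (pat : Tape × Fin N → Bool)

/-- All cells that should be `1` have been seen to be `1`. -/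
def allSeen (v : WatchBit N → Bool) : Bool :=
  decide (∀ y, pat y = true → (v (.inr (.inr (.inr y))) || v (.inr (.inr (.inl y)))) = true)

/-- The bits written by the machine `watch`. -/
def watchOut (s : State p.numWork × ℕ) (v w : WatchBit N → Bool) : Bool → WatchBit N → Bool
  | true, .inr (.inl t) => (p.next s.1 fun t => w (.inr (.inl t))).2.1 t
  | true, i => w i
  | false, .inl false => decide (∃ y, pat y = false ∧ v (.inr (.inr (.inl y))) = true)
  | false, .inl true => allSeen pat v
  | false, .inr (.inl t) => v (.inr (.inl t))
  | false, .inr (.inr (.inl y)) =>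
    if (y.2 : ℕ) = s.2 then (p.next s.1 fun t => w (.inr (.inl t))).2.1 y.1
    else v (.inr (.inr (.inl y)))
  | false, .inr (.inr (.inr y)) =>
    !allSeen pat v && (v (.inr (.inr (.inr y))) || v (.inr (.inr (.inl y))))

/-- The machine that carries out the program `p`, and at limit stages detects whether the first `N`
cells agree with `pat`. -/
noncomputable def watch : ControlMachine where
  ι := WatchBit N
  fin := inferInstance
  dec := inferInstance
  flagA := .inl false
  flagB := .inl true
  flags_ne := by simp
  S := State p.numWork × ℕ
  prim := inferInstance
  start := (.start, 0)
  limit := (.limit, 0)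
  addr := Prod.snd
  next s _ w := ((p.next s.1 fun t => w (.inr (.inl t))).1,
    (p.next s.1 fun t => w (.inr (.inl t))).2.2.move s.2)
  out := watchOut p pat
  addr_prim := Primrec.snd
  next_prim v w := by
    refine Primrec.pair ?_ (primrec_move ?_ Primrec.snd)
    · exact (Primrec.dom_finite fun st : State p.numWork =>
        (p.next st fun t => w (.inr (.inl t))).1).comp Primrec.fst
    · exact (Primrec.dom_finite fun st : State p.numWork =>
        (match (p.next st fun t => w (.inr (.inl t))).2.2 with
          | .left => true | .right => false : Bool)).comp Primrec.fst
  out_prim v w far i := by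
    have hbit : ∀ t, Primrec fun s : State p.numWork × ℕ =>
        (p.next s.1 fun t => w (.inr (.inl t))).2.1 t := fun t =>
      (Primrec.dom_finite fun st : State p.numWork =>
        (p.next st fun t => w (.inr (.inl t))).2.1 t).comp Primrec.fst
    cases far with
    | true =>
      rcases i with i | t | y | y
      · exact Primrec.const _
      · exact hbit t
      · exact Primrec.const _
      · exact Primrec.const _
    | false =>
      rcases i with (_ | _) | t | y | y
      · exact Primrec.const _
      · exact Primrec.const _
      · exact Primrec.const _
      · exact Primrec.ite (Primrec.eq.comp (Primrec.const _) Primrec.snd) (hbit y.1)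
          (Primrec.const _)
      · exact Primrec.const _

open ControlMachine

/-- The machine `watch` in step with the program `p`. -/
structure WatchInv (c : (watch p pat).Conf) (d : Config p.numWork) : Prop where
  state : c.state = (d.state, d.head)
  cell : ∀ h t, c.mem (h + 1) (.inr (.inl t)) = d.cell t h
  copy : ∀ y, c.mem 0 (.inr (.inr (.inl y))) = d.cell y.1 y.2

variable {p pat}

theorem WatchInv.step {c : (watch p pat).Conf} {d : Config p.numWork} (h : WatchInv p pat c d)
    (hd : d.state ≠ .halt) : WatchInv p pat (step c) (p.step d) := by
  have hbits : (fun t => c.mem (d.head + 1) (.inr (.inl t))) = fun t => d.cell t d.head :=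
    funext fun t => h.cell _ t
  have haddr : (watch p pat).addr c.state = d.head := by rw [h.state]; rfl
  rw [p.step_of_ne hd]
  refine ⟨?_, fun k t => ?_, fun y => ?_⟩
  · change ((p.next c.state.1 fun t => c.mem (c.state.2 + 1) (.inr (.inl t))).1,
      (p.next c.state.1 fun t => c.mem (c.state.2 + 1) (.inr (.inl t))).2.2.move c.state.2) = _
    rw [h.state]
    simp only [hbits]
  · by_cases hk : k = d.head
    · subst hk
      have := congrFun (step_mem_blk c true) (.inr (.inl t))
      rw [haddr] at this
      refine this.trans ?_
      change (p.next c.state.1 fun t => c.mem (d.head + 1) (.inr (.inl t))).2.1 t = _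
      rw [hbits, h.state]
      exact (Function.update_self d.head _ (d.cell t)).symm
    · have := step_mem_of_ne c (v := k + 1) (by rw [haddr]; intro far; cases far <;> simp [blk, hk])
      rw [this, h.cell]
      exact (Function.update_of_ne hk _ _).symm
  · have := congrFun (step_mem_blk c false) (.inr (.inr (.inl y)))
    refine this.trans ?_
    rw [haddr]
    change (if (y.2 : ℕ) = c.state.2 then
      (p.next c.state.1 fun t => c.mem (d.head + 1) (.inr (.inl t))).2.1 y.1
      else c.mem 0 (.inr (.inr (.inl y)))) = _
    rw [hbits, h.state, h.copy]
    simp only [Function.update_apply]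

/-- The simulation is in real time, one step for one step. Every cell and every copy in block `0`
therefore goes through the same sequence of values as in `p`, and has the same limsup. -/
theorem watchInv_run (x : ℕ → Bool) (hx : x = fun _ => false) (γ : Ordinal.{u})
    (h : ∀ δ < γ, (p.run x δ).state ≠ .halt) :
    WatchInv p pat ((watch p pat).run γ) (p.run x γ) := by
  induction γ using Ordinal.limitRecOn with
  | zero =>
    subst hx
    rw [Program.run_zero, ControlMachine.run_zero]
    refine ⟨rfl, fun h t => ?_, fun y => ?_⟩
    · cases t <;> rfl
    · obtain ⟨t, k⟩ := y
      cases t <;> rfl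
  | add_one γ ih =>
    rw [Program.run_add_one, ControlMachine.run_add_one]
    exact (ih fun δ hδ => h δ (hδ.trans (Order.lt_add_one_iff.2 le_rfl))).step
      (h γ (Order.lt_add_one_iff.2 le_rfl))
  | limit γ hγ ih =>
    have ih' : ∀ δ < γ, WatchInv p pat ((watch p pat).run δ) (p.run x δ) :=
      fun δ hδ => ih δ hδ fun ε hε => h ε (hε.trans hδ)
    refine ⟨?_, fun k t => ?_, fun y => ?_⟩
    · rw [ControlMachine.run_limit_state _ hγ, p.run_limit_state x hγ, p.run_limit_head x hγ]
      rfl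
    · rw [Bool.eq_iff_iff]
      refine (ControlMachine.run_limit_mem _ hγ _ _).trans (Iff.trans ?_
        (p.run_limit_cell x hγ _ _).symm)
      exact limSup_congr fun δ hδ => (ih' δ hδ).cell k t
    · rw [Bool.eq_iff_iff]
      refine (ControlMachine.run_limit_mem _ hγ _ _).trans (Iff.trans ?_
        (p.run_limit_cell x hγ _ _).symm)
      exact limSup_congr fun δ hδ => (ih' δ hδ).copy y

/-- Flag `A` is `1` at `o` exactly if some cell that should be `0` is `1` cofinally often; flag `B`
is `1` exactly if each cell that should be `1` is so cofinally often. The copies are needed because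
a step sees only block `0` and one further block. -/
theorem watch_accepts_iff {o : Ordinal.{u}} (ho : Order.IsSuccLimit o)
    (h : ∀ δ < o, (p.run (fun _ => false) δ).state ≠ .halt) :
    Accepts ((watch p pat).run o) ↔
      ∀ y : Tape × Fin N, (p.run (fun _ => false) o).cell y.1 y.2 = pat y := by
  have inv : ∀ γ < o, WatchInv p pat ((watch p pat).run γ) (p.run (fun _ => false) γ) :=
    fun γ hγ => watchInv_run _ rfl γ fun δ hδ => h δ (hδ.trans hγ)
  have hmem0 : ∀ γ i, ((watch p pat).run (γ + 1)).mem 0 i =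
      watchOut p pat ((watch p pat).run γ).state (((watch p pat).run γ).mem 0)
        (((watch p pat).run γ).mem ((watch p pat).addr ((watch p pat).run γ).state + 1)) false i := by
    intro γ i
    rw [ControlMachine.run_add_one]
    exact congrFun (step_mem_blk _ false) i
  have hlim : ∀ γ < o, Order.IsSuccLimit γ → ∀ i, ((watch p pat).run γ).mem 0 i = true ↔
      LimSup (fun γ => ((watch p pat).run γ).mem 0 i) γ :=
    fun γ _ hγ i => ControlMachine.run_limit_mem _ hγ _ _
  have hA : ((watch p pat).run o).mem 0 (.inl false) = true ↔
      ∃ y : {y // pat y = false}, (p.run (fun _ => false) o).cell y.1.1 y.1.2 = true := by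
    refine (ControlMachine.run_limit_mem _ ho _ _).trans ?_
    simp only [p.run_limit_cell _ ho]
    refine (limSup_shift (e := fun γ => decide (∃ y, pat y = false ∧
        ((watch p pat).run γ).mem 0 (.inr (.inr (.inl y))) = true)) ho
      (fun γ _ => hmem0 γ (.inl false)) (fun γ hγ hl => (hlim γ hγ hl _).1)).trans ?_
    refine limSup_exists (a := fun (y : {y // pat y = false}) γ =>
      (p.run (fun _ => false) γ).cell y.1.1 y.1.2) ho.bot_lt fun γ hγ => ?_
    simp only [decide_eq_true_eq, Subtype.exists, exists_prop]
    exact exists_congr fun y => and_congr_right fun _ => by rw [(inv γ hγ).copy]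
  have hB : ((watch p pat).run o).mem 0 (.inl true) = true ↔
      ∀ y : {y // pat y = true}, (p.run (fun _ => false) o).cell y.1.1 y.1.2 = true := by
    refine (ControlMachine.run_limit_mem _ ho _ _).trans ?_
    simp only [p.run_limit_cell _ ho]
    refine limSup_roundRobin (full := fun γ => allSeen pat (((watch p pat).run γ).mem 0))
      (r := fun (y : {y // pat y = true}) γ =>
        ((watch p pat).run γ).mem 0 (.inr (.inr (.inr y.1)))) ho
      (fun γ hγ => ?_) (fun γ _ => hmem0 γ _) (fun γ hγ y => ?_)
      (fun γ hγ hl => (hlim γ hγ hl _).1) (fun γ hγ hl y => hlim γ hγ hl _)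
    · simp only [allSeen, decide_eq_true_eq, Subtype.forall]
      exact forall_congr' fun y => forall_congr' fun _ => by rw [(inv γ hγ).copy]
    · refine (hmem0 γ (.inr (.inr (.inr y.1)))).trans ?_
      rw [← (inv γ hγ).copy y.1]
      rfl
  unfold Accepts
  change ((watch p pat).run o).mem 0 (.inl false) = false ∧
    ((watch p pat).run o).mem 0 (.inl true) = true ↔ _
  rw [← Bool.not_eq_true, hA, hB]
  constructor
  · rintro ⟨h0, h1⟩ y
    cases hy : pat y with
    | true => exact h1 ⟨y, hy⟩
    | false => exact Bool.eq_false_iff.2 fun hc => h0 ⟨⟨y, hy⟩, hc⟩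
  · intro hall
    exact ⟨fun ⟨y, hy⟩ => by rw [hall, y.2] at hy; exact Bool.noConfusion hy,
      fun y => by rw [hall, y.2]⟩

end

/-- Computations of `n` steps depend on the first `n` cells only. -/
theorem Program.iterate_step_congr (p : Program) {N : ℕ} {c d : Config p.numWork}
    (hs : c.state = d.state) (hc : c.head = 0) (hd : d.head = 0)
    (h : ∀ t, ∀ k < N, c.cell t k = d.cell t k) (n : ℕ) (hn : n ≤ N) :
    (p.step^[n] c).state = (p.step^[n] d).state ∧ (p.step^[n] c).head = (p.step^[n] d).head ∧
      (p.step^[n] c).head ≤ n ∧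
      ∀ t, ∀ k < N, (p.step^[n] c).cell t k = (p.step^[n] d).cell t k := by
  induction n with
  | zero => exact ⟨hs, by simp [hc, hd], by simp [hc], h⟩
  | succ n ih =>
    obtain ⟨h1, h2, h3, h4⟩ := ih (by omega)
    rw [Function.iterate_succ_apply', Function.iterate_succ_apply']
    set c' := p.step^[n] c
    set d' := p.step^[n] d
    by_cases hh : c'.state = .halt
    · have e1 : p.step c' = c' := if_pos hh
      have e2 : p.step d' = d' := if_pos (h1 ▸ hh)
      rw [e1, e2]
      exact ⟨h1, h2, by omega, h4⟩
    · have hb : (fun t => c'.cell t c'.head) = fun t => d'.cell t d'.head :=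
        funext fun t => by rw [← h2]; exact h4 t _ (by omega)
      rw [p.step_of_ne hh, p.step_of_ne (h1 ▸ hh), ← hb, ← h1, ← h2]
      refine ⟨rfl, rfl, ?_, fun t k hk => ?_⟩
      · simp only
        cases (p.next c'.state fun t => c'.cell t c'.head).2.2 <;> simp only [Dir.move] <;> omega
      · simp only [Function.update_apply, h4 t k hk]

/-- If `α` is a limit and `α + n` is clockable, then `α` is clockable. -/
theorem Clockable.of_add_nat {α : Ordinal.{u}} (hα : Order.IsSuccLimit α) {n : ℕ}
    (h : Clockable (α + n)) : Clockable α := by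
  obtain ⟨p, h1, h2⟩ := h
  obtain ⟨q, m, rfl⟩ := exists_block α
  have hm : m = 0 := by
    rcases Nat.eq_zero_or_pos m with h | h
    · exact h
    · obtain ⟨m, rfl⟩ := Nat.exists_eq_succ_of_ne_zero h.ne'
      rw [Nat.cast_succ, ← add_assoc] at hα
      exact absurd hα (Order.not_isSuccLimit_add_one _)
  subst hm
  rw [Nat.cast_zero, add_zero] at *
  have hq : q ≠ 0 := by
    rintro rfl
    simp at hα
  set x : ℕ → Bool := fun _ => false with hx
  -- The halt state is reached `n + 1` steps after `ω * q`, so `n + 1` cells of each tape determine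
  -- what happens.
  set pat : Tape × Fin (n + 1) → Bool := fun y => (p.run x (ω * q)).cell y.1 y.2 with hpat
  have hno : ∀ δ < ω * q, (p.run x δ).state ≠ .halt :=
    fun δ hδ => h1 δ (hδ.le.trans le_self_add)
  refine (watch p pat).clockable hq ((watch_accepts_iff hα hno).2 fun y => rfl) ?_
  intro q' hq' h0 hacc
  have hlt : ω * q' < ω * q := by simpa using block_lt 0 hq'
  have hl := isSuccLimit_block h0
  have hcells := (watch_accepts_iff hl fun δ hδ => hno δ (hδ.trans hlt)).1 hacc
  -- With the same first cells at `ω * q'`, the program would be in the halt state at `ω * q' + n +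
  -- 1`, which is before `ω * q`.
  have := (p.iterate_step_congr (N := n + 1) (c := p.run x (ω * q')) (d := p.run x (ω * q))
    (by rw [p.run_limit_state x hl, p.run_limit_state x hα]) (p.run_limit_head x hl)
    (p.run_limit_head x hα) (fun t k hk => hcells (t, ⟨k, hk⟩)) (n + 1) le_rfl).1
  rw [← p.run_add_nat, ← p.run_add_nat, Nat.cast_add_one, ← add_assoc, ← add_assoc, h2] at this
  refine hno _ ?_ this
  have := block_lt (n + 1) hq'
  rwa [Nat.cast_add_one, ← add_assoc] at this

/-! ### An enumeration of all programs -/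

/-- The number of a state. -/
def State.toNat {n : ℕ} : State n → ℕ
  | .start => 0
  | .limit => 1
  | .halt => 2
  | .work i => i + 3

/-- The state with a given number. -/
def State.ofNat (n : ℕ) : ℕ → State n
  | 0 => .start
  | 1 => .limit
  | 2 => .halt
  | k + 3 => if h : k < n then .work ⟨k, h⟩ else .halt

theorem State.ofNat_toNat {n : ℕ} (s : State n) : State.ofNat n s.toNat = s := by
  cases s with
  | work i => simp [toNat, ofNat]
  | _ => rfl

theorem State.toNat_ofNat {n k : ℕ} (h : k < n + 3) : (State.ofNat n k).toNat = k := by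
  match k, h with
  | 0, _ => rfl
  | 1, _ => rfl
  | 2, _ => rfl
  | k + 3, h =>
    have : k < n := by omega
    simp [ofNat, this, toNat]

theorem State.toNat_lt {n : ℕ} (s : State n) : s.toNat < n + 3 := by
  cases s with
  | work i => simp [toNat]
  | _ => simp [toNat]

theorem State.toNat_eq_two {n : ℕ} {s : State n} : s.toNat = 2 ↔ s = .halt := by
  cases s <;> simp [toNat]

/-- The number of a triple of bits. -/
def bitsNat (b : Tape → Bool) : ℕ :=
  (b .input).toNat + 2 * (b .scratch).toNat + 4 * (b .output).toNat

theorem bitsNat_lt (b : Tape → Bool) : bitsNat b < 8 := by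
  have := Bool.toNat_lt (b .input)
  have := Bool.toNat_lt (b .scratch)
  have := Bool.toNat_lt (b .output)
  unfold bitsNat
  omega

theorem bitsNat_injective : Function.Injective bitsNat := by
  intro a b h
  unfold bitsNat at h
  have h1 := Bool.toNat_lt (a .input)
  have h2 := Bool.toNat_lt (a .scratch)
  have h3 := Bool.toNat_lt (a .output)
  have h4 := Bool.toNat_lt (b .input)
  have h5 := Bool.toNat_lt (b .scratch)
  have h6 := Bool.toNat_lt (b .output)
  have key : ∀ x y : Bool, x.toNat = y.toNat → x = y := by decide
  funext t
  cases t
  · exact key _ _ (by omega)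
  · exact key _ _ (by omega)
  · exact key _ _ (by omega)

/-- A function of the tapes as a triple. -/
def tripleOf (b : Tape → Bool) : Bool × Bool × Bool := (b .input, b .scratch, b .output)

/-- A triple as a function of the tapes. -/
def ofTriple (x : Bool × Bool × Bool) : Tape → Bool
  | .input => x.1
  | .scratch => x.2.1
  | .output => x.2.2

/-- A direction from a bit. -/
def dirOf (b : Bool) : Dir := bif b then .left else .right

/-- A code for a program: the number of states besides the distinguished ones, and a table. -/
abbrev ProgramCode : Type := ℕ × List (ℕ × (Bool × Bool × Bool) × Bool)

namespace ProgramCode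

/-- The entry of the table for the state of number `s` and the bits of number `b`. -/
def entry (c : ProgramCode) (s b : ℕ) : ℕ × (Bool × Bool × Bool) × Bool :=
  c.2[8 * s + b]?.getD (2, (false, false, false), false)

/-- The number of the new state. -/
def newState (c : ProgramCode) (s b : ℕ) : ℕ :=
  if (c.entry s b).1 < c.1 + 3 then (c.entry s b).1 else 2

/-- The program with a given code. -/
def program (c : ProgramCode) : Program where
  numWork := c.1
  next s b := (State.ofNat c.1 (c.newState s.toNat (bitsNat b)),
    ofTriple (c.entry s.toNat (bitsNat b)).2.1, dirOf (c.entry s.toNat (bitsNat b)).2.2)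

theorem newState_lt (c : ProgramCode) (s b : ℕ) : c.newState s b < c.1 + 3 := by
  unfold newState
  split_ifs with h
  · exact h
  · omega

/-- The list has an entry for each of the `numWork + 3` states and each of the eight triples of
bits, so the defaults in `entry` and `newState` are never used here. -/
theorem exists_program (p : Program) : ∃ c : ProgramCode, c.program = p := by
  classical
  have hinv : ∀ b, Function.invFun bitsNat (bitsNat b) = b :=
    Function.leftInverse_invFun bitsNat_injective
  let e : ℕ → ℕ × (Bool × Bool × Bool) × Bool := fun m =>
    let r := p.next (State.ofNat p.numWork (m / 8)) (Function.invFun bitsNat (m % 8))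
    (r.1.toNat, tripleOf r.2.1, match r.2.2 with | .left => true | .right => false)
  let c : ProgramCode := (p.numWork, (List.range (8 * (p.numWork + 3))).map e)
  have hentry : ∀ (s : State p.numWork) b, c.entry s.toNat (bitsNat b) =
      ((p.next s b).1.toNat, tripleOf (p.next s b).2.1,
        match (p.next s b).2.2 with | .left => true | .right => false) := by
    intro s b
    have h1 := s.toNat_lt
    have h2 := bitsNat_lt b
    have h3 : (8 * s.toNat + bitsNat b) / 8 = s.toNat := by omega
    have h4 : (8 * s.toNat + bitsNat b) % 8 = bitsNat b := by omega
    have h5 : 8 * s.toNat + bitsNat b < 8 * (p.numWork + 3) := by omega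
    simp [entry, c, e, h3, h4, h5, hinv, State.ofNat_toNat]
  refine ⟨c, ?_⟩
  have hnext : ∀ (s : State p.numWork) b, c.program.next s b = p.next s b := by
    intro s b
    have h6 : c.newState s.toNat (bitsNat b) = (p.next s b).1.toNat := by
      unfold newState
      rw [hentry]
      exact if_pos (State.toNat_lt _)
    change (State.ofNat c.1 (c.newState s.toNat (bitsNat b)),
      ofTriple (c.entry s.toNat (bitsNat b)).2.1, dirOf (c.entry s.toNat (bitsNat b)).2.2) = _
    rw [h6, hentry]
    refine Prod.ext (State.ofNat_toNat _) (Prod.ext ?_ ?_)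
    · funext t
      cases t <;> rfl
    · simp only
      cases (p.next s b).2.2 <;> rfl
  cases p with
  | mk n f => exact congrArg (Program.mk n) (funext fun s => funext fun b => hnext s b)

/-- The code of number `i`. -/
def ofNat (i : ℕ) : ProgramCode := (Encodable.decode i).getD (0, [])

theorem exists_ofNat (p : Program) : ∃ i, (ofNat i).program = p := by
  obtain ⟨c, rfl⟩ := exists_program p
  exact ⟨Encodable.encode c, by simp [ofNat]⟩

theorem primrec_ofNat : Primrec ofNat :=
  Primrec.option_getD.comp Primrec.decode (Primrec.const _)

theorem primrec_entry (b : ℕ) : Primrec₂ fun (c : ProgramCode) (s : ℕ) => c.entry s b :=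
  Primrec.option_getD.comp
    (Primrec.list_getElem?.comp (Primrec.snd.comp Primrec.fst)
      (Primrec.nat_add.comp (Primrec.nat_mul.comp (Primrec.const 8) Primrec.snd)
        (Primrec.const b)))
    (Primrec.const _)

theorem primrec_newState (b : ℕ) : Primrec₂ fun (c : ProgramCode) (s : ℕ) => c.newState s b :=
  Primrec.ite
    (Primrec.nat_lt.comp (Primrec.fst.comp (primrec_entry b))
      (Primrec.nat_add.comp (Primrec.fst.comp Primrec.fst) (Primrec.const 3)))
    (Primrec.fst.comp (primrec_entry b)) (Primrec.const 2)

end ProgramCode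

theorem countable_program : Countable Program :=
  Function.Surjective.countable (f := fun i => (ProgramCode.ofNat i).program)
    ProgramCode.exists_ofNat

/-! ### The machine that simulates all programs -/

/-- The bits of a block of the machine `universal`: flags, the cells of the tapes, and a bit that
records that the program had halted. -/
abbrev UBit : Type := Bool ⊕ Option Tape

/-- The control state of the machine `universal`: the number of the state in which all programs
were at the beginning of the block, the number of steps since, and a list of the states and head
positions. -/
abbrev UState : Type := ℕ × ℕ × List (ℕ × ℕ)

namespace UState

/-- The program that is served. -/
def idx (s : UState) : ℕ := s.2.1.unpair.1

/-- The state and the head position of program `j`. -/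
def look (s : UState) (j : ℕ) : ℕ × ℕ := s.2.2[j]?.getD (s.1, 0)

/-- The state and the head position of the program that is served. -/
def cur (s : UState) : ℕ × ℕ := s.look s.idx

/-- The bits read. -/
def wbits (w : UBit → Bool) : Tape → Bool := fun t => w (.inr (some t))

/-- The program that is served has halted. -/
def idle (s : UState) (w : UBit → Bool) : Bool := w (.inr none) || decide (s.cur.1 = 2)

/-- The entry of the table that is applied. -/
def tableEntry (s : UState) (w : UBit → Bool) : ℕ × (Bool × Bool × Bool) × Bool :=
  (ProgramCode.ofNat s.idx).entry s.cur.1 (bitsNat (wbits w))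

/-- The new state of the program that is served. -/
def newState (s : UState) (w : UBit → Bool) : ℕ :=
  bif s.idle w then 2 else (ProgramCode.ofNat s.idx).newState s.cur.1 (bitsNat (wbits w))

/-- The new head position of the program that is served. -/
def newHead (s : UState) (w : UBit → Bool) : ℕ :=
  if s.newState w = 2 then 0 else (dirOf (s.tableEntry w).2.2).move s.cur.2

/-- The next control state. -/
def next (s : UState) (w : UBit → Bool) : UState :=
  (s.1, s.2.1 + 1, (List.range (max s.2.2.length (s.idx + 1))).map fun j =>
    if j = s.idx then (s.newState w, s.newHead w) else s.look j)

/-- The bits written, where the first flag reports that some program halts at the beginning of the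
block, or that program `i₀` had not halted. -/
def out (i₀ : ℕ) (s : UState) (v w : UBit → Bool) : Bool → UBit → Bool
  | true, .inl b => w (.inl b)
  | true, .inr (some t) =>
    bif s.idle w then w (.inr (some t)) else ofTriple (s.tableEntry w).2.1 t
  | true, .inr none => s.idle w
  | false, .inl false => (decide (s.2.1 ≠ 0) && v (.inl false)) ||
    (decide (s.2.1.unpair.2 = 0) && !w (.inr none) &&
      (decide (s.idx = i₀) || decide (s.newState w = 2)))
  | false, .inl true => true
  | false, .inr o => v (.inr o)

theorem look_next (s : UState) (w : UBit → Bool) (j : ℕ) :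
    (s.next w).look j = if j = s.idx then (s.newState w, s.newHead w) else s.look j := by
  by_cases h : j < max s.2.2.length (s.idx + 1)
  · simp only [look, next, List.getElem?_map, List.getElem?_range h, Option.map_some,
      Option.getD_some]
  · have h1 : j ≠ s.idx := by
      rintro rfl
      exact h (lt_max_of_lt_right (Nat.lt_succ_self _))
    have h2 : s.2.2.length ≤ j := (le_max_left _ _).trans (not_lt.1 h)
    rw [if_neg h1]
    simp only [look, next]
    rw [List.getElem?_eq_none (by simpa using not_lt.1 h), List.getElem?_eq_none h2]

theorem primrec_idx : Primrec idx := Primrec.fst.comp (Primrec.unpair.comp (Primrec.fst.comp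
  Primrec.snd))

theorem primrec_look : Primrec₂ look :=
  Primrec.option_getD.comp
    (Primrec.list_getElem?.comp (Primrec.snd.comp (Primrec.snd.comp Primrec.fst)) Primrec.snd)
    (Primrec.pair (Primrec.fst.comp Primrec.fst) (Primrec.const 0))

theorem primrec_cur : Primrec cur := primrec_look.comp Primrec.id primrec_idx

theorem primrec_idle (w : UBit → Bool) : Primrec fun s : UState => s.idle w :=
  Primrec.or.comp (Primrec.const _)
    (Primrec.eq.decide.comp (Primrec.fst.comp primrec_cur) (Primrec.const 2))

theorem primrec_tableEntry (w : UBit → Bool) : Primrec fun s : UState => s.tableEntry w :=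
  (ProgramCode.primrec_entry _).comp (ProgramCode.primrec_ofNat.comp primrec_idx)
    (Primrec.fst.comp primrec_cur)

theorem primrec_newState (w : UBit → Bool) : Primrec fun s : UState => s.newState w :=
  Primrec.cond (primrec_idle w) (Primrec.const 2)
    ((ProgramCode.primrec_newState _).comp (ProgramCode.primrec_ofNat.comp primrec_idx)
      (Primrec.fst.comp primrec_cur))

theorem primrec_newHead (w : UBit → Bool) : Primrec fun s : UState => s.newHead w := by
  refine Primrec.ite (Primrec.eq.comp (primrec_newState w) (Primrec.const 2)) (Primrec.const 0)
    (primrec_move ?_ (Primrec.snd.comp primrec_cur))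
  exact (Primrec.dom_finite fun b : Bool =>
    (match dirOf b with | .left => true | .right => false : Bool)).comp
    (Primrec.snd.comp (Primrec.snd.comp (primrec_tableEntry w)))

theorem primrec_next (w : UBit → Bool) : Primrec fun s : UState => s.next w := by
  refine Primrec.pair Primrec.fst (Primrec.pair (Primrec.succ.comp (Primrec.fst.comp Primrec.snd))
    (Primrec.list_map (Primrec.list_range.comp (Primrec.nat_max.comp
      (Primrec.list_length.comp (Primrec.snd.comp Primrec.snd)) (Primrec.succ.comp primrec_idx)))
      ?_))
  exact Primrec.ite (Primrec.eq.comp Primrec.snd (primrec_idx.comp Primrec.fst))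
    (Primrec.pair ((primrec_newState w).comp Primrec.fst) ((primrec_newHead w).comp Primrec.fst))
    primrec_look

theorem primrec_out (i₀ : ℕ) (v w : UBit → Bool) (far : Bool) (i : UBit) :
    Primrec fun s : UState => out i₀ s v w far i := by
  cases far with
  | true =>
    rcases i with b | _ | t
    · exact Primrec.const _
    · exact primrec_idle w
    · exact Primrec.cond (primrec_idle w) (Primrec.const _)
        ((Primrec.dom_finite fun x : Bool × Bool × Bool => ofTriple x t).comp
          (Primrec.fst.comp (Primrec.snd.comp (primrec_tableEntry w))))
  | false =>
    rcases i with (_ | _) | o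
    · refine Primrec.or.comp (Primrec.and.comp ?_ (Primrec.const _)) (Primrec.and.comp
        (Primrec.and.comp ?_ (Primrec.const _)) (Primrec.or.comp ?_ ?_))
      · exact (Primrec.eq.comp (Primrec.fst.comp Primrec.snd) (Primrec.const 0)).not.decide
      · exact Primrec.eq.decide.comp (Primrec.snd.comp (Primrec.unpair.comp (Primrec.fst.comp
          Primrec.snd))) (Primrec.const 0)
      · exact Primrec.eq.decide.comp primrec_idx (Primrec.const _)
      · exact Primrec.eq.decide.comp (primrec_newState w) (Primrec.const _)
    · exact Primrec.const _
    · exact Primrec.const _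

end UState

/-- The machine that simulates all programs simultaneously, `ω` steps of each in every `ω` steps. -/
noncomputable abbrev universal (i₀ : ℕ) : ControlMachine where
  ι := UBit
  fin := inferInstance
  dec := inferInstance
  flagA := .inl false
  flagB := .inl true
  flags_ne := by simp
  S := UState
  prim := inferInstance
  start := (0, 0, [])
  limit := (1, 0, [])
  addr s := Nat.pair s.idx s.cur.2
  next s _ w := s.next w
  out := UState.out i₀
  addr_prim := Primrec₂.natPair.comp UState.primrec_idx (Primrec.snd.comp UState.primrec_cur)
  next_prim _ w := UState.primrec_next w
  out_prim v w far i := UState.primrec_out i₀ v w far i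

/-! ### The schedule of the simulation -/

/-- How often the program `i` has been served before step `n`. -/
def served (i n : ℕ) : ℕ := Nat.count (fun m => m.unpair.1 = i) n

/-- Program `i` is served exactly at the steps `Nat.pair i 0 < Nat.pair i 1 < ...`. -/
theorem lt_served_iff (i k n : ℕ) : k < served i n ↔ Nat.pair i k < n := by
  induction n generalizing k with
  | zero => simp [served]
  | succ n ih =>
    rw [served, Nat.count_succ]
    change k < served i n + _ ↔ _
    by_cases h : n.unpair.1 = i
    · have hn : Nat.pair i n.unpair.2 = n := by rw [← h, Nat.pair_unpair]
      have hk : served i n = n.unpair.2 := by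
        refine le_antisymm (not_lt.1 fun hlt => ?_) (not_lt.1 fun hlt => ?_)
        · have := (ih _).1 hlt
          omega
        · have h1 := Nat.pair_lt_pair_right i hlt
          rw [hn] at h1
          exact lt_irrefl _ ((ih _).2 h1)
      rw [if_pos h, hk]
      constructor
      · intro hlt
        rcases Nat.lt_succ_iff_lt_or_eq.1 hlt with h1 | h1
        · have := Nat.pair_lt_pair_right i h1
          omega
        · rw [h1]; omega
      · intro hlt
        by_contra hge
        have := Nat.pair_lt_pair_right i (show n.unpair.2 < k by omega)
        omega
    · rw [if_neg h, add_zero, ih]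
      constructor
      · intro h1; omega
      · intro h1
        rcases Nat.lt_succ_iff_lt_or_eq.1 h1 with h2 | h2
        · exact h2
        · exact absurd (by rw [← h2]; simp) h

theorem served_pair (i k : ℕ) : served i (Nat.pair i k) = k := by
  refine le_antisymm (not_lt.1 fun h => ?_) (not_lt.1 fun h => ?_)
  · exact lt_irrefl _ ((lt_served_iff _ _ _).1 h)
  · exact lt_irrefl _ ((lt_served_iff _ _ _).2 (Nat.pair_lt_pair_right i h))

theorem served_succ (i n : ℕ) :
    served i (n + 1) = if n.unpair.1 = i then served i n + 1 else served i n := by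
  rw [served, Nat.count_succ]
  split_ifs <;> rfl

theorem served_mono (i : ℕ) : Monotone (served i) := Nat.count_monotone _

/-- A sequence of bits and the same sequence in the time of the schedule. -/
theorem served_slowdown (i : ℕ) (f : ℕ → Bool) :
    ((∃ n, f (served i n) = true) ↔ ∃ k, f k = true) ∧
      ((∀ m, ∃ n ≥ m, f (served i n) = true) ↔ ∀ m, ∃ k ≥ m, f k = true) := by
  refine slowdown (a := fun n => f (served i n)) (τ := fun k => Nat.pair i k)
    (strictMono_nat_of_lt_succ fun k => Nat.pair_lt_pair_right i (Nat.lt_succ_self k))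
    (fun j hj => ?_) (fun k => by rw [served_pair]) (fun k j h1 h2 => ?_)
  · have : ¬ 0 < served i j := fun h => by have := (lt_served_iff _ _ _).1 h; omega
    rw [show served i j = 0 by omega]
  · have h3 := served_mono i h1
    have h4 := served_mono i h2.le
    rw [served_pair] at h3 h4
    rcases (show served i j = k ∨ served i j = k + 1 by omega) with h | h <;> simp [h]

/-! ### Correctness of the simulation -/

/-- The configurations of the program of number `i` on input `0`. -/
noncomputable def cfg (i : ℕ) (γ : Ordinal.{u}) : Config (ProgramCode.ofNat i).program.numWork :=
  (ProgramCode.ofNat i).program.run (fun _ => false) γ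

theorem cfg_add_one (i : ℕ) (γ : Ordinal.{u}) :
    cfg i (γ + 1) = (ProgramCode.ofNat i).program.step (cfg i γ) :=
  Program.run_add_one _ _ _

theorem cfg_succ (i : ℕ) (o : Ordinal.{u}) (k : ℕ) :
    cfg i (o + (k + 1 : ℕ)) = (ProgramCode.ofNat i).program.step (cfg i (o + k)) := by
  rw [Nat.cast_add_one, ← add_assoc, cfg_add_one]

/-- The program of number `i` halts before stage `o`. -/
def HaltedBefore (i : ℕ) (o : Ordinal.{u}) : Prop := ∃ γ < o, (cfg i γ).state = .halt

theorem cfg_halt_mono {i : ℕ} {o : Ordinal.{u}} {k m : ℕ} (hkm : k ≤ m)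
    (h : (cfg i (o + k)).state = .halt) : (cfg i (o + m)).state = .halt := by
  induction m, hkm using Nat.le_induction with
  | base => exact h
  | succ m _ ih =>
    rw [cfg_succ]
    have : (ProgramCode.ofNat i).program.step (cfg i (o + m)) = cfg i (o + m) := if_pos ih
    rw [this, ih]

open ControlMachine

section

variable {i₀ : ℕ}

/-- The program in the configuration `d` is simulated as number `i`. -/
structure Running (C : (universal i₀).Conf) (i : ℕ)
    (d : Config (ProgramCode.ofNat i).program.numWork) : Prop where
  state : d.state ≠ .halt
  look : UState.look C.state i = (d.state.toNat, d.head)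
  cell : ∀ h t, C.mem (Nat.pair i h + 1) (.inr (some t)) = d.cell t h
  fresh : ∀ h, C.mem (Nat.pair i h + 1) (.inr none) = false

/-- The block that is accessed. -/
def slot (C : (universal i₀).Conf) : ℕ :=
  Nat.pair (UState.idx C.state) (UState.cur C.state).2 + 1

theorem step_look (C : (universal i₀).Conf) (j : ℕ) :
    UState.look (step C).state j = if j = UState.idx C.state then
      (UState.newState C.state (C.mem (slot C)), UState.newHead C.state (C.mem (slot C)))
      else UState.look C.state j :=
  UState.look_next C.state (C.mem (slot C)) j

theorem step_slot (C : (universal i₀).Conf) (b : UBit) :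
    (step C).mem (slot C) b = UState.out i₀ C.state (C.mem 0) (C.mem (slot C)) true b :=
  congrFun (step_mem_blk C true) b

theorem step_zero (C : (universal i₀).Conf) (b : UBit) :
    (step C).mem 0 b = UState.out i₀ C.state (C.mem 0) (C.mem (slot C)) false b :=
  congrFun (step_mem_blk C false) b

theorem step_other (C : (universal i₀).Conf) {v : ℕ} (hv : v + 1 ≠ slot C) :
    (step C).mem (v + 1) = C.mem (v + 1) :=
  step_mem_of_ne C fun far => by
    cases far with
    | false => exact Nat.succ_ne_zero v
    | true => exact hv

theorem slot_ne {C : (universal i₀).Conf} {i : ℕ} (hi : i ≠ UState.idx C.state) (h : ℕ) :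
    Nat.pair i h + 1 ≠ slot C := fun e =>
  hi (Nat.pair_eq_pair.1 (Nat.succ_injective e)).1

/-- The record of halting is overwritten only by `idle`, which is true as soon as the record is. -/
theorem sticky (C : (universal i₀).Conf) (v : ℕ) (h : C.mem (v + 1) (.inr none) = true) :
    (step C).mem (v + 1) (.inr none) = true := by
  by_cases hv : v + 1 = slot C
  · rw [hv] at h ⊢
    rw [step_slot]
    simp [UState.out, UState.idle, h]
  · rw [step_other C hv, h]

theorem Running.step {C : (universal i₀).Conf} {i : ℕ}
    {d : Config (ProgramCode.ofNat i).program.numWork} (h : Running C i d)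
    (hi : UState.idx C.state = i) :
    (((ProgramCode.ofNat i).program.step d).state ≠ .halt →
      Running (step C) i ((ProgramCode.ofNat i).program.step d)) ∧
    (((ProgramCode.ofNat i).program.step d).state = .halt →
      UState.look (ControlMachine.step C).state i = (2, 0)) ∧
    (UState.newState C.state (C.mem (slot C)) = 2 ↔
      ((ProgramCode.ofNat i).program.step d).state = .halt) := by
  have hcur : UState.cur C.state = (d.state.toNat, d.head) := by
    rw [UState.cur, hi, h.look]
  have hslot : slot C = Nat.pair i d.head + 1 := by rw [slot, hcur, hi]
  have hbits : UState.wbits (C.mem (slot C)) = fun t => d.cell t d.head := by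
    funext t
    rw [hslot]
    exact h.cell _ _
  have hidle : UState.idle C.state (C.mem (slot C)) = false := by
    unfold UState.idle
    rw [hcur, hslot, h.fresh]
    simpa [State.toNat_eq_two] using h.state
  have hentry : UState.tableEntry C.state (C.mem (slot C)) =
      (ProgramCode.ofNat i).entry d.state.toNat (bitsNat fun t => d.cell t d.head) := by
    rw [UState.tableEntry, hbits, hcur, hi]
  have hnew : UState.newState C.state (C.mem (slot C)) =
      ((ProgramCode.ofNat i).program.step d).state.toNat := by
    rw [UState.newState, hidle, hbits, hcur, hi, Program.step_of_ne _ h.state]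
    exact (State.toNat_ofNat (ProgramCode.newState_lt _ _ _)).symm
  have hiff : UState.newState C.state (C.mem (slot C)) = 2 ↔
      ((ProgramCode.ofNat i).program.step d).state = .halt := by
    rw [hnew, State.toNat_eq_two]
  refine ⟨fun hd => ⟨hd, ?_, fun k t => ?_, fun k => ?_⟩, fun hd => ?_, hiff⟩
  · rw [step_look, if_pos hi.symm, UState.newHead, if_neg (fun e => hd (hiff.1 e)), hnew, hentry,
      hcur, Program.step_of_ne _ h.state]
    rfl
  · by_cases hk : k = d.head
    · subst hk
      rw [← hslot, step_slot]
      simp only [UState.out, hidle, hentry, cond_false]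
      rw [Program.step_of_ne _ h.state]
      exact (Function.update_self d.head _ (d.cell t)).symm
    · rw [step_other C, h.cell, Program.step_of_ne _ h.state]
      · exact (Function.update_of_ne hk _ _).symm
      · rw [hslot]
        exact fun e => hk (Nat.pair_eq_pair.1 (Nat.succ_injective e)).2
  · by_cases hk : k = d.head
    · subst hk
      rw [← hslot, step_slot]
      exact hidle
    · rw [step_other C, h.fresh]
      rw [hslot]
      exact fun e => hk (Nat.pair_eq_pair.1 (Nat.succ_injective e)).2
  · rw [step_look, if_pos hi.symm, UState.newHead, if_pos (hiff.2 hd), hiff.2 hd]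

theorem Running.step_of_ne {C : (universal i₀).Conf} {i : ℕ}
    {d : Config (ProgramCode.ofNat i).program.numWork} (h : Running C i d)
    (hi : i ≠ UState.idx C.state) : Running (ControlMachine.step C) i d :=
  ⟨h.state, by rw [step_look, if_neg hi, h.look],
    fun k t => by rw [step_other C (slot_ne hi k), h.cell],
    fun k => by rw [step_other C (slot_ne hi k), h.fresh]⟩

/-- The invariant of the simulation of the program of number `i`, which was in the stage `o` at
the beginning of the block and has been served `k` times since. -/
def Simulated (C : (universal i₀).Conf) (i : ℕ) (o : Ordinal.{u}) (k : ℕ) : Prop :=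
  (¬ HaltedBefore i o ∧ Running C i (cfg i (o + k))) ∨
  (¬ HaltedBefore i o ∧ (cfg i (o + k)).state = .halt ∧ UState.look C.state i = (2, 0) ∧
    ((∃ k' < k, (cfg i (o + k')).state = .halt) →
      C.mem (Nat.pair i 0 + 1) (.inr none) = true)) ∨
  (HaltedBefore i o ∧ (UState.look C.state i).2 = 0 ∧
    C.mem (Nat.pair i 0 + 1) (.inr none) = true)

theorem step_look_of_idle {C : (universal i₀).Conf} {i : ℕ} (hi : UState.idx C.state = i)
    (h : UState.idle C.state (C.mem (slot C)) = true) :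
    UState.look (step C).state i = (2, 0) := by
  rw [step_look, if_pos hi.symm, UState.newHead, UState.newState, h]
  rfl

/-- A program that halts is parked at head position `0`. The next time it is served, the record of
halting is written, into the block of its first cell. This is the block that is visited first after
a limit stage, when the control has forgotten everything. -/
theorem Simulated.step {C : (universal i₀).Conf} {i : ℕ} {o : Ordinal.{u}} {k : ℕ}
    (h : Simulated C i o k) (hi : UState.idx C.state = i) :
    Simulated (ControlMachine.step C) i o (k + 1) := by
  rcases h with ⟨hb, h⟩ | ⟨hb, h1, h2, h3⟩ | ⟨hb, h2, h3⟩
  · obtain ⟨r1, r2, _⟩ := h.step hi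
    rw [← cfg_succ] at r1 r2
    by_cases hd : (cfg i (o + (k + 1 : ℕ))).state = .halt
    · refine .inr (.inl ⟨hb, hd, r2 hd, ?_⟩)
      rintro ⟨k', hk', hh⟩
      exact absurd (cfg_halt_mono (Nat.lt_succ_iff.1 hk') hh) h.state
    · exact .inl ⟨hb, r1 hd⟩
  · have hcur : UState.cur C.state = (2, 0) := by rw [UState.cur, hi, h2]
    have hslot : slot C = Nat.pair i 0 + 1 := by rw [slot, hcur, hi]
    have hidle : UState.idle C.state (C.mem (slot C)) = true := by
      simp [UState.idle, hcur]
    refine .inr (.inl ⟨hb, cfg_halt_mono (Nat.le_succ k) h1, step_look_of_idle hi hidle, fun _ => ?_⟩)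
    rw [← hslot, step_slot]
    exact hidle
  · have hslot : slot C = Nat.pair i 0 + 1 := by rw [slot, UState.cur, hi, h2]
    have hidle : UState.idle C.state (C.mem (slot C)) = true := by
      simp [UState.idle, hslot, h3]
    refine .inr (.inr ⟨hb, by rw [step_look_of_idle hi hidle], sticky _ _ h3⟩)

theorem Simulated.step_of_ne {C : (universal i₀).Conf} {i : ℕ} {o : Ordinal.{u}} {k : ℕ}
    (h : Simulated C i o k) (hi : i ≠ UState.idx C.state) :
    Simulated (ControlMachine.step C) i o k := by
  have hl : UState.look (ControlMachine.step C).state i = UState.look C.state i := by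
    rw [step_look, if_neg hi]
  rcases h with ⟨hb, h⟩ | ⟨hb, h1, h2, h3⟩ | ⟨hb, h2, h3⟩
  · exact .inl ⟨hb, h.step_of_ne hi⟩
  · exact .inr (.inl ⟨hb, h1, by rw [hl, h2], fun hk => sticky _ _ (h3 hk)⟩)
  · exact .inr (.inr ⟨hb, by rw [hl, h2], sticky _ _ h3⟩)

end

variable (i₀ : ℕ)

/-- The computation of the machine `universal`. -/
noncomputable def uni (γ : Ordinal.{u}) : (universal i₀).Conf := (universal i₀).run γ

theorem uni_succ (o : Ordinal.{u}) (n : ℕ) : uni i₀ (o + (n + 1 : ℕ)) = step (uni i₀ (o + n)) :=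
  run_add_nat_succ _ _ _

theorem uni_limit_mem {o : Ordinal.{u}} (ho : Order.IsSuccLimit o) (v : ℕ) (b : UBit) :
    (uni i₀ o).mem v b = true ↔ LimSup (fun γ => (uni i₀ γ).mem v b) o :=
  (universal i₀).run_limit_mem ho v b

theorem uni_sticky {v : ℕ} {γ δ : Ordinal.{u}} (h : (uni i₀ γ).mem (v + 1) (.inr none) = true)
    (hle : γ ≤ δ) : (uni i₀ δ).mem (v + 1) (.inr none) = true := by
  induction δ using Ordinal.limitRecOn with
  | zero => rwa [← nonpos_iff_eq_zero.1 hle]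
  | add_one δ ih =>
    rcases hle.eq_or_lt with rfl | hlt
    · exact h
    · have := ih (Order.lt_add_one_iff.1 hlt)
      rw [uni, run_add_one]
      exact sticky _ _ this
  | limit δ hδ ih =>
    rcases hle.eq_or_lt with rfl | hlt
    · exact h
    · refine (uni_limit_mem i₀ hδ _ _).2 fun ε hε => ⟨max ε γ, max_lt hε hlt, le_max_left _ _, ?_⟩
      exact ih _ (max_lt hε hlt) (le_max_right _ _)

theorem uni_block_state (q : Ordinal.{u}) (n : ℕ) :
    UState.idx (uni i₀ (ω * q + n)).state = n.unpair.1 ∧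
      ((uni i₀ (ω * q + n)).state : UState).2.1 = n := by
  have key : ((uni i₀ (ω * q + n)).state : UState).2.1 = n := by
    induction n with
    | zero =>
      rw [Nat.cast_zero, add_zero]
      by_cases hq : q = 0
      · subst hq
        rw [mul_zero, uni, run_zero]
      · rw [uni, run_limit_state _ (isSuccLimit_block hq)]
    | succ n ih =>
      rw [uni_succ]
      change ((uni i₀ (ω * q + n)).state : UState).2.1 + 1 = n + 1
      rw [ih]
  exact ⟨by rw [UState.idx, key], key⟩

/-- At the beginning of a block the list of states is empty, and the default of `look` is right for
every program: start or limit state, head on the first cell. A halted program is an exception only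
in the simulation, where the record of halting tells. -/
theorem look_block (i : ℕ) (q : Ordinal.{u}) :
    UState.look (uni i₀ (ω * q)).state i =
      ((cfg i (ω * q)).state.toNat, (cfg i (ω * q)).head) ∧ (cfg i (ω * q)).state ≠ .halt ∧
      (cfg i (ω * q)).head = 0 := by
  by_cases hq : q = 0
  · subst hq
    simp only [mul_zero, uni, run_zero, cfg, Program.run_zero]
    exact ⟨rfl, nofun, rfl⟩
  · have hl := isSuccLimit_block hq
    rw [uni, run_limit_state _ hl, cfg, Program.run_limit_state _ _ hl,
      Program.run_limit_head _ _ hl]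
    exact ⟨rfl, nofun, rfl⟩

/-- The simulation of the program of number `i` is correct at the beginning of a block. -/
def Correct (i : ℕ) (o : Ordinal.{u}) : Prop :=
  (¬ HaltedBefore i o →
    (∀ h t, (uni i₀ o).mem (Nat.pair i h + 1) (.inr (some t)) = (cfg i o).cell t h) ∧
    ∀ h, (uni i₀ o).mem (Nat.pair i h + 1) (.inr none) = false) ∧
  (HaltedBefore i o → (uni i₀ o).mem (Nat.pair i 0 + 1) (.inr none) = true)

variable {i₀}

theorem Correct.simulated {i : ℕ} {q : Ordinal.{u}} (h : Correct i₀ i (ω * q)) (n : ℕ) :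
    Simulated (uni i₀ (ω * q + n)) i (ω * q) (served i n) := by
  induction n with
  | zero =>
    obtain ⟨l1, l2, l3⟩ := look_block i₀ i q
    have hs : served i 0 = 0 := rfl
    rw [hs, Nat.cast_zero, add_zero]
    by_cases hb : HaltedBefore i (ω * q)
    · exact .inr (.inr ⟨hb, by rw [l1, l3], h.2 hb⟩)
    · refine .inl ⟨hb, ?_⟩
      rw [Nat.cast_zero, add_zero]
      exact ⟨l2, l1, (h.1 hb).1, (h.1 hb).2⟩
  | succ n ih =>
    have hidx := (uni_block_state i₀ q n).1
    rw [uni_succ, served_succ]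
    split_ifs with hi
    · exact ih.step (hidx.trans hi)
    · exact ih.step_of_ne fun e => hi (by rw [← hidx, e])

/-- Induction on the blocks. While a program runs, its cells in the memory repeat its computation in
the time of the schedule, and `served_slowdown` shows that the limsups agree. If it has halted, the
record of halting persists through limits. -/
theorem correct (i : ℕ) (q : Ordinal.{u}) : Correct i₀ i (ω * q) := by
  induction q using WellFoundedLT.induction with
  | ind q ih =>
    by_cases hq : q = 0
    · subst hq
      rw [mul_zero]
      refine ⟨fun _ => ⟨fun h t => ?_, fun h => ?_⟩, fun ⟨γ, hγ, _⟩ => by simp at hγ⟩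
      · rw [uni, run_zero, cfg, Program.run_zero]
        cases t <;> rfl
      · rw [uni, run_zero]
    · have hl := isSuccLimit_block hq
      refine ⟨fun hb => ?_, fun hb => ?_⟩
      · have hno : ∀ q' < q, ∀ k : ℕ, (cfg i (ω * q' + k)).state ≠ .halt :=
          fun q' hq' k hk => hb ⟨_, block_lt k hq', hk⟩
        have hrun : ∀ q' < q, ∀ n : ℕ, Running (uni i₀ (ω * q' + n)) i
            (cfg i (ω * q' + served i n)) := by
          intro q' hq' n
          rcases (ih q' hq').simulated n with ⟨_, h⟩ | ⟨_, h, _⟩ | ⟨⟨γ, hγ, h⟩, _⟩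
          · exact h
          · exact absurd h (hno q' hq' _)
          · exact absurd ⟨γ, hγ.trans (by simpa using block_lt 0 hq'), h⟩ hb
        refine ⟨fun h t => ?_, fun h => ?_⟩
        · rw [Bool.eq_iff_iff, uni_limit_mem i₀ hl]
          refine Iff.trans ?_ (Program.run_limit_cell _ _ hl _ _).symm
          refine limSup_congr_blocks (fun q' hq' => ?_) (fun q' hq' => ?_)
          · simp only [(hrun q' hq' _).cell]
            exact (served_slowdown i fun k => (cfg i (ω * q' + k)).cell t h).1
          · simp only [(hrun q' hq' _).cell]
            exact (served_slowdown i fun k => (cfg i (ω * q' + k)).cell t h).2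
        · rw [← Bool.not_eq_true, uni_limit_mem i₀ hl, not_limSup]
          refine ⟨0, hl.bot_lt, fun γ hγ _ => ?_⟩
          obtain ⟨q', n, rfl⟩ := exists_block γ
          exact (hrun q' (lt_of_block_lt hγ) n).fresh h
      · obtain ⟨γ, hγ, hh⟩ := hb
        obtain ⟨q', m, rfl⟩ := exists_block γ
        have hq' := lt_of_block_lt hγ
        -- The program is in the halt state after being served `m` times in block `q'`; serving it
        -- once more writes the record, hence `m + 1`.
        refine uni_sticky i₀ (γ := ω * q' + (Nat.pair i (m + 1) : ℕ)) ?_ (block_lt _ hq').le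
        have := (ih q' hq').simulated (Nat.pair i (m + 1))
        rw [served_pair] at this
        rcases this with ⟨_, h⟩ | ⟨_, _, _, h⟩ | ⟨_, _, h⟩
        · exact absurd (cfg_halt_mono (Nat.le_succ m) hh) h.state
        · exact h ⟨m, Nat.lt_succ_self m, hh⟩
        · exact h

/-! ### The flag that reports events at the beginning of a block -/

/-- The program of number `i` has not halted before `o`, and halts at `o` or is the one of
number `i₀`. -/
def Event (i₀ i : ℕ) (o : Ordinal.{u}) : Prop :=
  ¬ HaltedBefore i o ∧ (i = i₀ ∨ (cfg i (o + 1)).state = .halt)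

/-- The flag is cleared at step `0` of each block and otherwise kept. It can be raised only when a
program is served for the first time in the block, for that step simulates the one from `ω * q` to
`ω * q + 1`. -/
theorem flag_succ (q : Ordinal.{u}) (n : ℕ) :
    (uni i₀ (ω * q + (n + 1 : ℕ))).mem 0 (.inl false) = true ↔
      (n ≠ 0 ∧ (uni i₀ (ω * q + n)).mem 0 (.inl false) = true) ∨
        (n.unpair.2 = 0 ∧ Event i₀ n.unpair.1 (ω * q)) := by
  obtain ⟨hidx, hn⟩ := uni_block_state i₀ q n
  have hsim := (correct (i₀ := i₀) n.unpair.1 q).simulated n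
  rw [uni_succ, step_zero]
  simp only [UState.out, Bool.or_eq_true, Bool.and_eq_true, decide_eq_true_eq, Bool.not_eq_true',
    hn, hidx]
  refine or_congr Iff.rfl ?_
  rw [and_assoc]
  refine and_congr_right fun h0 => ?_
  have hs : served n.unpair.1 n = 0 := by
    conv_lhs => rw [← Nat.pair_unpair n, h0]
    rw [Nat.unpair_pair, served_pair]
  rw [hs] at hsim
  rcases hsim with ⟨hb, h⟩ | ⟨hb, h, _⟩ | ⟨hb, h1, h2⟩
  · obtain ⟨_, _, h3⟩ := h.step hidx
    have hslot : slot (uni i₀ (ω * q + n)) =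
        Nat.pair n.unpair.1 (cfg n.unpair.1 (ω * q + (0 : ℕ))).head + 1 := by
      rw [slot, UState.cur, hidx, h.look]
    rw [h3, Nat.cast_zero, add_zero, ← cfg_add_one]
    rw [hslot, h.fresh]
    simp [Event, hb]
  · rw [Nat.cast_zero, add_zero] at h
    exact absurd h (look_block i₀ _ q).2.1
  · have hslot : slot (uni i₀ (ω * q + n)) = Nat.pair n.unpair.1 0 + 1 := by
      rw [slot, UState.cur, hidx, h1]
    rw [hslot, h2]
    simp [Event, hb]

theorem flag_iff (q : Ordinal.{u}) (n : ℕ) :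
    (uni i₀ (ω * q + (n + 1 : ℕ))).mem 0 (.inl false) = true ↔
      ∃ m ≤ n, m.unpair.2 = 0 ∧ Event i₀ m.unpair.1 (ω * q) := by
  induction n with
  | zero =>
    rw [flag_succ]
    constructor
    · rintro (⟨h, _⟩ | h)
      · exact absurd rfl h
      · exact ⟨0, le_rfl, h⟩
    · rintro ⟨m, hm, h⟩
      rw [Nat.le_zero.1 hm] at h
      exact .inr h
  | succ n ih =>
    rw [flag_succ, ih]
    constructor
    · rintro (⟨_, m, hm, h⟩ | h)
      · exact ⟨m, by omega, h⟩
      · exact ⟨n + 1, le_rfl, h⟩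
    · rintro ⟨m, hm, h⟩
      rcases hm.eq_or_lt with rfl | hlt
      · exact .inr h
      · exact .inl ⟨Nat.succ_ne_zero n, m, by omega, h⟩

/-- Every block below `ω * q'` has an event, after which its flag stays up to the end of the block;
so the flag is up cofinally often. -/
theorem flag_of_event {q' : Ordinal.{u}} (hq' : q' ≠ 0)
    (h : ∀ q < q', ∃ i, Event i₀ i (ω * q)) :
    (uni i₀ (ω * q')).mem 0 (.inl false) = true := by
  refine (uni_limit_mem i₀ (isSuccLimit_block hq') _ _).2 fun δ hδ => ?_
  obtain ⟨r, m, rfl⟩ := exists_block δ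
  have hr := lt_of_block_lt hδ
  obtain ⟨i, hi⟩ := h r hr
  -- The event of program `i` raises the flag at step `Nat.pair i 0`; adding `m` gives a stage that
  -- is also beyond `δ`.
  refine ⟨ω * r + (m + Nat.pair i 0 + 1 : ℕ), block_lt _ hr, ?_, ?_⟩
  · exact add_le_add_right (Nat.cast_le.2 (by omega)) _
  · exact (flag_iff r _).2 ⟨Nat.pair i 0, by omega, by simpa using hi⟩

/-- Whatever the flag was at the limit stage `ω * q`, the first step of the block clears it and
nothing raises it again, so it is `0` from `ω * q + 1` on. -/
theorem not_flag_of_not_event {q : Ordinal.{u}} (h : ∀ i, ¬ Event i₀ i (ω * q)) :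
    (uni i₀ (ω * (q + 1))).mem 0 (.inl false) = false := by
  have hl : Order.IsSuccLimit (ω * (q + 1)) := isSuccLimit_block (by simp)
  have hlt : q < q + 1 := Order.lt_add_one_iff.2 le_rfl
  rw [← Bool.not_eq_true, uni_limit_mem i₀ hl, not_limSup]
  refine ⟨ω * q + (1 : ℕ), block_lt 1 hlt, fun γ hγ hle => ?_⟩
  obtain ⟨ε, rfl⟩ := le_iff_exists_add.1 (le_self_add.trans hle)
  rw [mul_add_one, add_lt_add_iff_left] at hγ
  obtain ⟨n, rfl⟩ := lt_omega0.1 hγ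
  obtain ⟨n, rfl⟩ := Nat.exists_eq_succ_of_ne_zero (show n ≠ 0 by
    rintro rfl
    simp at hle)
  rw [← Bool.not_eq_true]
  intro hf
  obtain ⟨m, _, _, hm⟩ := (flag_iff q n).1 hf
  exact h _ hm

theorem universal_flagB {q : Ordinal.{u}} (hq : q ≠ 0) :
    (uni i₀ (ω * q)).mem 0 (.inl true) = true := by
  have hl := isSuccLimit_block hq
  refine (uni_limit_mem i₀ hl _ _).2 fun δ hδ => ⟨δ + 1, hl.add_one_lt hδ, le_self_add, ?_⟩
  change ((universal i₀).run (δ + 1)).mem 0 (.inl true) = true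
  rw [run_add_one]
  exact step_zero _ _

/-- If `α` is clockable and `ω * q` is the first multiple of `ω` above `α` that is not, then
`ω * q + ω` is clockable. -/
theorem clockable_add_omega {α q : Ordinal.{u}} (hα : Clockable α) (hlt : α < ω * q)
    (hq : ¬ Clockable (ω * q)) (hmin : ∀ q' < q, α < ω * q' → Clockable (ω * q')) :
    Clockable (ω * q + ω) := by
  obtain ⟨p, hp1, hp2⟩ := hα
  obtain ⟨i₀, rfl⟩ := ProgramCode.exists_ofNat p
  have hq0 : q ≠ 0 := by
    rintro rfl
    simp at hlt
  -- Multiples of `ω` above `α` are clockable by `hmin`. For those up to `α`, where nothing is known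
  -- about clockability, the program `i₀` that clocks `α` serves as an event because it is still
  -- running.
  have hev : ∀ q' < q, ∃ i, Event i₀ i (ω * q') := by
    intro q' hq'
    by_cases h : α < ω * q'
    · obtain ⟨p, h1, h2⟩ := hmin q' hq' h
      obtain ⟨i, rfl⟩ := ProgramCode.exists_ofNat p
      exact ⟨i, fun ⟨γ, hγ, hh⟩ => h1 γ hγ.le hh, .inr h2⟩
    · exact ⟨i₀, fun ⟨γ, hγ, hh⟩ => hp1 γ (hγ.le.trans (not_lt.1 h)) hh, .inl rfl⟩
  -- At `ω * q` the program `i₀` has already halted, and a program halting in exactly `ω * q` steps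
  -- would make `ω * q` clockable.
  have hnev : ∀ i, ¬ Event i₀ i (ω * q) := by
    rintro i ⟨hb, rfl | h⟩
    · exact hb ⟨α + 1, (isSuccLimit_block hq0).add_one_lt hlt, hp2⟩
    · refine hq ⟨_, fun γ hγ hh => ?_, h⟩
      rcases hγ.lt_or_eq with hlt | rfl
      · exact hb ⟨γ, hlt, hh⟩
      · exact (look_block i₀ i q).2.1 hh
  rw [← mul_add_one]
  refine (universal i₀).clockable (by simp) ⟨not_flag_of_not_event hnev, universal_flagB (by simp)⟩
    fun q' hq' h0 hacc => ?_
  have hle : q' ≤ q := Order.lt_add_one_iff.1 hq'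
  have := flag_of_event h0 fun r hr => hev r (hr.trans_le hle)
  exact Bool.noConfusion (this.symm.trans hacc.1)

/-! ### Gaps -/

theorem clockable_zero : Clockable (0 : Ordinal.{u}) := by
  refine ⟨⟨0, fun _ b => (.halt, b, .left)⟩, fun γ hγ => ?_, ?_⟩
  · rw [nonpos_iff_eq_zero.1 hγ, Program.run_zero]
    exact nofun
  · rw [Program.run_add_one, Program.run_zero, Program.step_of_ne _ (by simp [initial])]

/-- The clockable ordinals are bounded. -/
theorem exists_forall_clockable_le : ∃ δ : Ordinal.{u}, ∀ γ, Clockable γ → γ ≤ δ := by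
  have := countable_program
  have hc : {γ : Ordinal.{u} | Clockable γ}.Countable := by
    refine Set.Countable.mono (s₂ := ⋃ p : Program, {γ | p.HaltsIn (fun _ => false) γ})
      -- Each program clocks at most one ordinal: of two such ordinals, the larger one would come
      -- after the halt state had been reached.
      (fun γ ⟨p, hp⟩ => Set.mem_iUnion.2 ⟨p, hp⟩) (Set.countable_iUnion fun p => ?_)
    refine Set.Subsingleton.countable fun γ hγ δ hδ => ?_
    by_contra hne
    rcases lt_or_gt_of_ne hne with h | h
    · exact hδ.1 _ (Order.add_one_le_of_lt h) hγ.2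
    · exact hγ.1 _ (Order.add_one_le_of_lt h) hδ.2
  have hs : Small.{u} {γ : Ordinal.{u} | Clockable γ} := by
    have := hc.to_subtype
    infer_instance
  obtain ⟨δ, hδ⟩ := bddAbove_of_small (s := {γ : Ordinal.{u} | Clockable γ})
  exact ⟨δ, fun γ hγ => hδ hγ⟩

theorem exists_isFirstGapAbove {α : Ordinal.{u}} (hα : Clockable α) :
    ∃ β, IsFirstGapAbove α β ω := by
  obtain ⟨δ, hδ⟩ := exists_forall_clockable_le.{u}
  have hno : ∃ β, α < β ∧ ¬ Clockable β := by
    refine ⟨max α δ + 1, Order.lt_add_one_iff.2 (le_max_left _ _), fun h => ?_⟩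
    exact absurd ((hδ _ h).trans (le_max_right α δ)) (not_le.2 (Order.lt_add_one_iff.2 le_rfl))
  let β := sInf {β | α < β ∧ ¬ Clockable β}
  obtain ⟨hβ, hβc⟩ : α < β ∧ ¬ Clockable β := csInf_mem hno
  have hmin : ∀ γ, α < γ → γ < β → Clockable γ := fun γ h1 h2 => by
    by_contra h
    exact notMem_of_lt_csInf' h2 ⟨h1, h⟩
  have hle : ∀ γ, α ≤ γ → γ < β → Clockable γ := fun γ h1 h2 => by
    rcases h1.eq_or_lt with rfl | h
    · exact hα
    · exact hmin γ h h2
  -- If `β` were a successor, its predecessor would be `α` or lie between `α` and `β`, hence be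
  -- clockable, and then so would `β`.
  have hlim : Order.IsSuccLimit β := by
    rcases zero_or_succ_or_isSuccLimit β with h | ⟨γ, h⟩ | h
    · rw [h] at hβ
      simp at hβ
    · have hγ : α ≤ γ := Order.lt_succ_iff.1 (hβ.trans_eq h.symm)
      have := (hle γ hγ (by rw [← h]; exact Order.lt_succ γ)).add_one
      rw [← Order.succ_eq_add_one, h] at this
      exact absurd this hβc
    · exact h
  have hq : ∃ q, β = ω * q := by
    obtain ⟨q, n, h⟩ := exists_block β
    cases n with
    | zero => exact ⟨q, by simpa using h⟩
    | succ n =>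
      rw [Nat.cast_succ, ← add_assoc] at h
      rw [h] at hlim
      exact absurd hlim (Order.not_isSuccLimit_add_one _)
  obtain ⟨q, hq⟩ := hq
  have hnot : ∀ γ, β ≤ γ → γ < β + ω → ¬ Clockable γ := by
    intro γ h1 h2 hc
    obtain ⟨ε, rfl⟩ := le_iff_exists_add.1 h1
    obtain ⟨n, rfl⟩ := lt_omega0.1 ((add_lt_add_iff_left _).1 h2)
    exact hβc (hc.of_add_nat hlim)
  have hend : Clockable (β + ω) := by
    rw [hq] at hβ hβc hmin ⊢
    refine clockable_add_omega hα hβ hβc fun q' hq' h => hmin _ h ?_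
    simpa using block_lt 0 hq'
  refine ⟨β, hβ, ⟨omega0_pos, hnot, fun δ hδ => ?_, hend⟩, fun β' σ' h1 h2 => ?_⟩
  -- Maximality of the gap to the left: all ordinals from `α` up to `β` are clockable, so there is
  -- one of them in every `[δ, β)`.
  · exact ⟨max α δ, le_max_right _ _, max_lt hβ hδ, hle _ (le_max_left _ _) (max_lt hβ hδ)⟩
  -- A gap that begins strictly between `α` and `β` would have a clockable first element.
  · by_contra hlt
    refine h2.2.1 β' le_rfl ?_ (hmin β' h1 (not_le.1 hlt))
    simpa using h2.1

end ITTM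

theorem mainTheorem8 :
    (∃ β σ : Ordinal.{u}, ITTM.IsGap β σ) ∧
    (∀ α : Ordinal.{u}, ITTM.Clockable α →
      ∃ β : Ordinal.{u}, ITTM.IsFirstGapAbove α β Ordinal.omega0) := by
  refine ⟨?_, fun α hα => ITTM.exists_isFirstGapAbove hα⟩
  obtain ⟨β, h⟩ := ITTM.exists_isFirstGapAbove ITTM.clockable_zero.{u}
  exact ⟨β, _, h.2.1⟩
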